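/- Let $\mathbb K$ be a field, $\mathbf T=(T_0,T_1)$, $d>1$, and let $f=(f_0,f_1,f_2)\in\mathbb K[\mathbf T]^3$ be linearly independent over $\mathbb K$, homogeneous of degree $d$, with $\gcd(f_0,f_1,f_2)=1$. Let $p,q$ be a homogeneous basis of the syzygy module of $f$, of degrees $\mu\le d-\mu$, and let $A,B$ be a homogeneous basis of the syzygy module of $p=(p_0,p_1,p_2)$, of degrees $\mu_1\le\mu_2$, where $\mu=\mu_1+\mu_2$, scaled so that $f=p\times q$ and $p=A\times B$ (cross products). Assume $\mu_1>0$. Write $f=\alpha A+\beta B$ with $\alpha,\beta\in\mathbb K[\mathbf T]$ homogeneous of degrees $d-\mu_1,\,d-\mu_2$, and $A_j=\sum_{k} a_{j,k}T_0^{\mu_1-k}T_1^k$, $B_j=\sum_{k} b_{j,k}T_0^{\mu_2-k}T_1^k$. Let $s$, $X$, $Y$, $\mathbf Z=(Z_0,Z_1,Z_2)$, $\mathbf X=(X_0,\dots,X_{\mu_1})$, $\mathbf Y=(Y_0,\dots,Y_{\mu_2})$ be new variables, write $q$ also for the polynomial $q_0Z_0+q_1Z_1+q_2Z_2$, and consider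 the $\mathbb K[\mathbf T]$-algebra homomorphisms $$\psi:\mathbb K[\mathbf T,\mathbf Z]\to\mathbb K[\mathbf T,s],\ Z_j\mapsto f_js;\qquad \Gamma:\mathbb K[\mathbf T,\mathbf Z]\to\mathbb K[\mathbf T,\mathbf X,\mathbf Y],\ Z_j\mapsto\sum_k a_{j,k}X_k+\sum_k b_{j,k}Y_k;$$ $$\Phi:\mathbb K[\mathbf T,\mathbf X,\mathbf Y]\to\mathbb K[\mathbf T,s],\ X_i\mapsto \alpha T_0^{\mu_1-i}T_1^{i}s,\ Y_i\mapsto\beta T_0^{\mu_2-i}T_1^{i}s;$$ $$\Phi':\mathbb K[\mathbf T,\mathbf X,\mathbf Y]\to\mathbb K[\mathbf T,X,Y],\ X_i\mapsto T_0^{\mu_1-i}T_1^{i}X,\ Y_i\mapsto T_0^{\mu_2-i}T_1^{i}Y.$$ Put $\mathcal K=\ker\psi$, $\mathcal I=\ker\Phi$, $\mathcal I'=\ker\Phi'$. *The operators.* For $F\in\mathbb K[\mathbf T,\mathbf Z]$ of the form $F=\sum_{\ell}p_\ell F^{(\ell)}$ with $F^{(0)},F^{(1)},F^{(2)}$ bihomogeneous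 of one and the same bidegree in $(\mathbf T,\mathbf Z)$, let $D_B(F)$ be the determinant with rows $(F^{(0)},F^{(1)},F^{(2)})$, $(Z_0,Z_1,Z_2)$, $(A_0,A_1,A_2)$, and let $D_A(F)$ be the same determinant with last row $(B_0,B_1,B_2)$; the values depend on the choice of the $F^{(\ell)}$. We write $D_A^aD_B^b(q)$ for any polynomial obtained from $q$ by applying $D_A$ $a$ times and $D_B$ $b$ times, in any order in which all the steps are possible and with any choices of the $F^{(\ell)}$. *The generators $\Psi$.* Let $S\subseteq\mathbb K[V_0,V_1,V_2]$ be the monomial ideal generated by the $V_0^iV_1^jV_2^k$ with $i+\mu_1j+\mu_2k\ge d-\mu$. If $V_0^iV_1^jV_2^k$ is one of the minimal monomial generators of $S$ and $0\le t\le \sigma:=i+(j+1)\mu_1+(k+1)\mu_2-d$, then $\Psi^t_{i,j,k+1}$ denotes any difference $P_1-P_2\in\mathcal I$ of polynomials $P_1,P_2\in\mathbb K[\mathbf T,\mathbf X,\mathbf Y]$ that are homogeneous in each of $\mathbf T,\mathbf X,\mathbf Y$, of degrees $(i,j,k+1)$ and $(i,j+1,k)$ respectively, such that substituting $X_n\mapsto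 T_0^{\mu_1-n}T_1^n$, $Y_n\mapsto T_0^{\mu_2-n}T_1^n$ in $P_1$ gives $\alpha T_0^tT_1^{\sigma-t}$. **Theorem.** Let $a,b\ge0$ be integers with either $b\ge1$ and $d-\mu-a\mu_1-b\mu_2\ge\mu-1$, or $b=0$ and $d-\mu-a\mu_1\ge\mu+\mu_2-\mu_1-1$. Then $D_A^aD_B^b(q)$ is defined, by first applying $D_A$ $a$ times and then $D_B$ $b$ times, and a polynomial $\Psi^0_{d-\mu-a\mu_1-b\mu_2,\,a,\,b+1}$ exists. Every value of $D_A^aD_B^b(q)$ is bihomogeneous of bidegree $(d-\mu-a\mu_1-b\mu_2,\ a+b+1)$, lies in $\mathcal K$, and belongs to some minimal system of bihomogeneous generators of $\mathcal K$; moreover $\Gamma(D_A^aD_B^b(q))\in\mathcal I$, and $$\Gamma\big(D_A^aD_B^b(q)\big)\equiv(-1)^{b+1}\,\Psi^0_{d-\mu-a\mu_1-b\mu_2,\,a,\,b+1}\pmod{\mathcal I'}$$ for every choice of $\Psi^0_{d-\mu-a\mu_1-b\mu_2,\,a,\,b+1}$. -/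

import Mathlib

open MvPolynomial
open scoped Matrix

namespace CurveRees

/-- `𝕜[T₀, T₁]`. -/
abbrev RT (𝕜 : Type*) [Field 𝕜] := MvPolynomial (Fin 2) 𝕜

/-- `𝕜[T₀, T₁, Z₀, Z₁, Z₂]`; `Sum.inl i` is `T_i`, `Sum.inr j` is `Z_j`. -/
abbrev RTZ (𝕜 : Type*) [Field 𝕜] := MvPolynomial (Fin 2 ⊕ Fin 3) 𝕜

/-- `𝕜[T₀, T₁, X₀, …, X_{μ₁}, Y₀, …, Y_{μ₂}]`; `Sum.inl i` is `T_i`, `Sum.inr (Sum.inl i)` is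
`X_i` and `Sum.inr (Sum.inr i)` is `Y_i`. -/
abbrev RTXY (𝕜 : Type*) [Field 𝕜] (μ₁ μ₂ : ℕ) :=
  MvPolynomial (Fin 2 ⊕ (Fin (μ₁ + 1) ⊕ Fin (μ₂ + 1))) 𝕜

/-- `𝕜[T₀, T₁, X, Y]`; `Sum.inr 0` is `X` and `Sum.inr 1` is `Y`. -/
abbrev RTxy (𝕜 : Type*) [Field 𝕜] := MvPolynomial (Fin 2 ⊕ Fin 2) 𝕜

/-- `𝕜[T₀, T₁, s]`. -/
abbrev RTs (𝕜 : Type*) [Field 𝕜] := MvPolynomial (Fin 2 ⊕ Unit) 𝕜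

section Defs

variable {𝕜 : Type*} [Field 𝕜]

/-! ### Syzygies and μ-bases -/

/-- The syzygy module `{h ∈ 𝕜[T]³ : h₀ f₀ + h₁ f₁ + h₂ f₂ = 0}`. -/
noncomputable def syzygies (f : Fin 3 → RT 𝕜) : Submodule (RT 𝕜) (Fin 3 → RT 𝕜) :=
  LinearMap.ker (Fintype.linearCombination (RT 𝕜) f)

/-- `u, v` is a homogeneous basis, of degrees `m ≤ n`, of the syzygy module of `f`. -/
structure IsMuBasis (f u v : Fin 3 → RT 𝕜) (m n : ℕ) : Prop where
  homogeneous_fst : ∀ i, (u i).IsHomogeneous m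
  homogeneous_snd : ∀ i, (v i).IsHomogeneous n
  le : m ≤ n
  linearIndependent : LinearIndependent (RT 𝕜) ![u, v]
  span_eq : Submodule.span (RT 𝕜) {u, v} = syzygies f

/-! ### The Rees ideal of the plane curve -/

/-- The inclusion `𝕜[T] ⊆ 𝕜[T, …]`. -/
noncomputable def incl {σ : Type*} : RT 𝕜 →ₐ[𝕜] MvPolynomial (Fin 2 ⊕ σ) 𝕜 :=
  rename Sum.inl

/-- `F ∈ 𝕜[T, Z]` is bihomogeneous of bidegree `(i, j)`: degree `i` in `T` and `j` in `Z`
(the zero polynomial has every bidegree). -/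
def IsBihomogeneous (F : RTZ 𝕜) (i j : ℕ) : Prop :=
  IsWeightedHomogeneous
    (Sum.elim (fun _ => (1, 0)) (fun _ => (0, 1)) : Fin 2 ⊕ Fin 3 → ℕ × ℕ) F (i, j)

/-- `ψ : 𝕜[T, Z] → 𝕜[T, s]`, `T_i ↦ T_i`, `Z_j ↦ f_j s`. -/
noncomputable def psi (f : Fin 3 → RT 𝕜) : RTZ 𝕜 →ₐ[𝕜] RTs 𝕜 :=
  aeval (Sum.elim (fun i => X (Sum.inl i)) (fun j => incl (f j) * X (Sum.inr ())))

/-- The ideal `𝓚 = ker ψ` of defining equations of the Rees algebra of `⟨f₀, f₁, f₂⟩`. -/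
noncomputable def idealK (f : Fin 3 → RT 𝕜) : Ideal (RTZ 𝕜) := RingHom.ker (psi f)

/-- `G` belongs to a minimal system of bihomogeneous generators of the ideal `J`. -/
def IsMinimalGenerator (J : Ideal (RTZ 𝕜)) (G : RTZ 𝕜) : Prop :=
  ∃ s : Set (RTZ 𝕜), (∀ F ∈ s, ∃ i j, IsBihomogeneous F i j) ∧ Ideal.span s = J ∧
    (∀ F ∈ s, F ∉ Ideal.span (s \ {F})) ∧ G ∈ s

/-- The polynomial `h₀ Z₀ + h₁ Z₁ + h₂ Z₂` of a vector `h ∈ 𝕜[T]³`. -/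
noncomputable def movingLine (h : Fin 3 → RT 𝕜) : RTZ 𝕜 :=
  ∑ j, incl (h j) * X (Sum.inr j)

/-! ### The operators `D_A` and `D_B` -/

/-- `G` is a value at `F` of the operator attached to `p` and the row `C`: for some expression
`F = ∑ ℓ, p_ℓ F^(ℓ)` with `F^(0), F^(1), F^(2)` bihomogeneous of one bidegree, `G` is the
determinant with rows `(F^(0), F^(1), F^(2))`, `(Z₀, Z₁, Z₂)`, `(C₀, C₁, C₂)`.
The operator `D_A` uses the row `C = B`, and `D_B` uses the row `C = A`. -/
def IsDValue (p C : Fin 3 → RT 𝕜) (F G : RTZ 𝕜) : Prop :=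
  ∃ H : Fin 3 → RTZ 𝕜, (∃ i j, ∀ l, IsBihomogeneous (H l) i j) ∧
    F = ∑ l, incl (p l) * H l ∧
    G = Matrix.det !![H 0, H 1, H 2;
                      X (Sum.inr 0), X (Sum.inr 1), X (Sum.inr 2);
                      incl (C 0), incl (C 1), incl (C 2)]

/-- `IsIterate p A B a b F G`: `G` is obtained from `F` by `a` applications of `D_A` and `b`
applications of `D_B`, in some order and with some choice of the expressions at each step. -/
inductive IsIterate (p A B : Fin 3 → RT 𝕜) : ℕ → ℕ → RTZ 𝕜 → RTZ 𝕜 → Prop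
  | refl (F : RTZ 𝕜) : IsIterate p A B 0 0 F F
  | stepA {a b : ℕ} {F G H : RTZ 𝕜} :
      IsIterate p A B a b F G → IsDValue p B G H → IsIterate p A B (a + 1) b F H
  | stepB {a b : ℕ} {F G H : RTZ 𝕜} :
      IsIterate p A B a b F G → IsDValue p A G H → IsIterate p A B a (b + 1) F H

/-! ### The space curve and its lift -/

/-- The monomial `T₀^(m-k) T₁^k`, for `k = 0, …, m`. -/
noncomputable def monT (m : ℕ) (k : Fin (m + 1)) : RT 𝕜 :=
  X 0 ^ (m - (k : ℕ)) * X 1 ^ (k : ℕ)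

/-- The coefficient of `T₀^(m-k) T₁^k` in `P`. -/
noncomputable def coeffT (m : ℕ) (P : RT 𝕜) (k : Fin (m + 1)) : 𝕜 :=
  coeff (Finsupp.single 0 (m - (k : ℕ)) + Finsupp.single 1 (k : ℕ)) P

/-- `Γ : 𝕜[T, Z] → 𝕜[T, X, Y]`, `T_i ↦ T_i`, `Z_j ↦ ∑ k, a_{j,k} X_k + ∑ k, b_{j,k} Y_k`, where
`A_j = ∑ k, a_{j,k} T₀^(μ₁-k) T₁^k` and `B_j = ∑ k, b_{j,k} T₀^(μ₂-k) T₁^k`. -/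
noncomputable def Gam (μ₁ μ₂ : ℕ) (A B : Fin 3 → RT 𝕜) : RTZ 𝕜 →ₐ[𝕜] RTXY 𝕜 μ₁ μ₂ :=
  aeval (Sum.elim (fun i => X (Sum.inl i)) (fun j =>
    (∑ k, C (coeffT μ₁ (A j) k) * X (Sum.inr (Sum.inl k))) +
      ∑ k, C (coeffT μ₂ (B j) k) * X (Sum.inr (Sum.inr k))))

/-- `Φ : 𝕜[T, X, Y] → 𝕜[T, s]`, `T_i ↦ T_i`, `X_i ↦ α T₀^(μ₁-i) T₁^i s`,
`Y_i ↦ β T₀^(μ₂-i) T₁^i s`. -/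
noncomputable def Phi (μ₁ μ₂ : ℕ) (α β : RT 𝕜) : RTXY 𝕜 μ₁ μ₂ →ₐ[𝕜] RTs 𝕜 :=
  aeval (Sum.elim (fun i => X (Sum.inl i)) (Sum.elim
    (fun k => incl (α * monT μ₁ k) * X (Sum.inr ()))
    (fun k => incl (β * monT μ₂ k) * X (Sum.inr ()))))

/-- The ideal `𝓘 = ker Φ`. -/
noncomputable def idealI (μ₁ μ₂ : ℕ) (α β : RT 𝕜) : Ideal (RTXY 𝕜 μ₁ μ₂) :=
  RingHom.ker (Phi μ₁ μ₂ α β)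

/-- `Φ' : 𝕜[T, X₀, …, X_{μ₁}, Y₀, …, Y_{μ₂}] → 𝕜[T, X, Y]`, `T_i ↦ T_i`,
`X_i ↦ T₀^(μ₁-i) T₁^i X`, `Y_i ↦ T₀^(μ₂-i) T₁^i Y`. -/
noncomputable def PhiPrime (𝕜 : Type*) [Field 𝕜] (μ₁ μ₂ : ℕ) : RTXY 𝕜 μ₁ μ₂ →ₐ[𝕜] RTxy 𝕜 :=
  aeval (Sum.elim (fun i => X (Sum.inl i)) (Sum.elim
    (fun k => incl (monT μ₁ k) * X (Sum.inr 0))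
    (fun k => incl (monT μ₂ k) * X (Sum.inr 1))))

/-- The kernel of `Φ'` is the ideal `𝓘'` of the scroll. -/
noncomputable def idealIPrime (𝕜 : Type*) [Field 𝕜] (μ₁ μ₂ : ℕ) : Ideal (RTXY 𝕜 μ₁ μ₂) :=
  RingHom.ker (PhiPrime 𝕜 μ₁ μ₂)

/-! ### The generators `Ψ^t_{i,j,k+1}` of `𝓘` -/

/-- The specialization `P ↦ P(T, T^{μ₁}, T^{μ₂})`: `X_i ↦ T₀^(μ₁-i) T₁^i`,
`Y_i ↦ T₀^(μ₂-i) T₁^i`. -/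
noncomputable def specialize (μ₁ μ₂ : ℕ) : RTXY 𝕜 μ₁ μ₂ →ₐ[𝕜] RT 𝕜 :=
  aeval (Sum.elim (fun i => X i) (Sum.elim (fun k => monT μ₁ k) (fun k => monT μ₂ k)))

/-- `P ∈ 𝕜[T, X, Y]` is trihomogeneous of degrees `i`, `j`, `k` in `T`, `X`, `Y`. -/
def IsTrihomogeneous {μ₁ μ₂ : ℕ} (P : RTXY 𝕜 μ₁ μ₂) (i j k : ℕ) : Prop :=
  IsWeightedHomogeneous
    (Sum.elim (fun _ => (1, 0, 0)) (Sum.elim (fun _ => (0, 1, 0)) (fun _ => (0, 0, 1))) :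
      Fin 2 ⊕ (Fin (μ₁ + 1) ⊕ Fin (μ₂ + 1)) → ℕ × ℕ × ℕ) P (i, j, k)

/-- The monomial `V₀^i V₁^j V₂^k`. -/
noncomputable def monV (𝕜 : Type*) [Field 𝕜] (i j k : ℕ) : MvPolynomial (Fin 3) 𝕜 :=
  X 0 ^ i * X 1 ^ j * X 2 ^ k

/-- The monomial ideal `S ⊆ 𝕜[V₀, V₁, V₂]` generated by the `V₀^i V₁^j V₂^k` with
`i + μ₁ j + μ₂ k ≥ d - (μ₁ + μ₂)`. -/
noncomputable def idealS (𝕜 : Type*) [Field 𝕜] (μ₁ μ₂ d : ℕ) :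
    Ideal (MvPolynomial (Fin 3) 𝕜) :=
  Ideal.span {m | ∃ i j k : ℕ, d ≤ i + μ₁ * j + μ₂ * k + (μ₁ + μ₂) ∧ m = monV 𝕜 i j k}

/-- `V₀^i V₁^j V₂^k` is one of the minimal monomial generators of `S`: it lies in `S` and no
proper divisor of it is a monomial of `S`. -/
def IsMinGenS (𝕜 : Type*) [Field 𝕜] (μ₁ μ₂ d i j k : ℕ) : Prop :=
  monV 𝕜 i j k ∈ idealS 𝕜 μ₁ μ₂ d ∧
    ∀ i₁ j₁ k₁ : ℕ, i₁ ≤ i → j₁ ≤ j → k₁ ≤ k → monV 𝕜 i₁ j₁ k₁ ∈ idealS 𝕜 μ₁ μ₂ d →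
      i₁ = i ∧ j₁ = j ∧ k₁ = k

/-- `P` is a choice of `Ψ^t_{i,j,k+1}`: `(i, j, k)` is the exponent of a minimal monomial generator
of `S`, `0 ≤ t ≤ s` with `s = i + (j+1) μ₁ + (k+1) μ₂ - d` (an integer `≥ 0`), and `P = P₁ - P₂`
where `P₁`, `P₂` are trihomogeneous of degrees `(i, j, k+1)`, `(i, j+1, k)`,
`P₁(T, T^{μ₁}, T^{μ₂}) = α T₀^t T₁^(s-t)` and `P₁ - P₂ ∈ 𝓘`. -/
def IsPsi (μ₁ μ₂ d : ℕ) (α β : RT 𝕜) (t i j k : ℕ) (P : RTXY 𝕜 μ₁ μ₂) : Prop :=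
  IsMinGenS 𝕜 μ₁ μ₂ d i j k ∧
    ∃ s : ℕ, s + d = i + (j + 1) * μ₁ + (k + 1) * μ₂ ∧ t ≤ s ∧
      ∃ P₁ P₂ : RTXY 𝕜 μ₁ μ₂, IsTrihomogeneous P₁ i j (k + 1) ∧ IsTrihomogeneous P₂ i (j + 1) k ∧
        specialize μ₁ μ₂ P₁ = α * X 0 ^ t * X 1 ^ (s - t) ∧
        P₁ - P₂ ∈ idealI μ₁ μ₂ α β ∧ P = P₁ - P₂

end Defs

end CurveRees

/-! Everything is read off in `𝕜[T, X, Y]` through `planeMap` = `Φ' ∘ Γ`, which sends `Z` to `A X +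
B Y`. From `f = (A × B) × q` and the independence of `A, B` one gets `α = -B·q` and `β = A·q`, so
`q` maps to `-(α Y - β X)`. Since `Z × B` becomes `X p` and `Z × A` becomes `-Y p`, an application
of `D_A` multiplies the image by `X` and one of `D_B` by `-Y`, whatever expression `F = ∑ p_ℓ F^(ℓ)`
is chosen (`planeMap_det`). Hence every value of `D_A^a D_B^b(q)` has image `-X^a (-Y)^b (α Y - β
X)`. By trihomogeneity `Φ'` sends every `Ψ⁰` to `X^a Y^b (α Y - β X)`, and this gives the
congruence.

Membership in `𝓚` and `𝓘` holds because `ψ` and `Φ` factor through `𝕜[T, X, Y]` by `X ↦ α s`, `Y ↦ β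
s`, which kills `α Y - β X`. For minimality, coprimality of `α, β` makes `α Y - β X` divide the
image of all of `𝓚` (`curveEq_dvd_planeMap`). As `A, B` have positive degree, an element of `𝔪 𝓚`
then has a quotient vanishing at `T = 0`. The quotient `-X^a (-Y)^b` does not, so graded Nakayama
applies (`exists_minimal_generators`).

The operators are defined because a dimension count puts all forms of degree at least `μ + μ₂ - 1`
in the ideal of `p` (`exists_isHomogeneous_combination`). -/

namespace CurveRees

/-! ### Weighted homogeneous components and scaling. -/

section WeightedHomogeneous

variable {R σ M : Type*} [CommRing R]

/-- The component of a product with a weighted homogeneous factor. -/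
theorem weightedHomogeneousComponent_mul_of_isWeightedHomogeneous [AddCancelCommMonoid M]
    {w : σ → M} {F : MvPolynomial σ R} {e : M} (hF : IsWeightedHomogeneous w F e)
    (c : MvPolynomial σ R) (n : M) :
    weightedHomogeneousComponent w (n + e) (c * F) = weightedHomogeneousComponent w n c * F := by
  classical
  induction c using MvPolynomial.induction_on' with
  | monomial s r =>
    have h := isWeightedHomogeneous_monomial w s r rfl
    have h' := h.mul hF
    by_cases hs : Finsupp.weight w s = n
    · rw [← hs, h'.weightedHomogeneousComponent_same, h.weightedHomogeneousComponent_same]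
    · rw [h'.weightedHomogeneousComponent_ne _ fun h0 => hs (add_right_cancel h0).symm,
        h.weightedHomogeneousComponent_ne _ (Ne.symm hs), zero_mul]
  | add p q hp hq => rw [add_mul, map_add, hp, hq, map_add, add_mul]

theorem weightedHomogeneousComponent_mul_eq_zero [AddCancelCommMonoid M]
    {w : σ → M} {F : MvPolynomial σ R} {e m : M} (hF : IsWeightedHomogeneous w F e)
    (c : MvPolynomial σ R) (hm : ∀ n, n + e ≠ m) :
    weightedHomogeneousComponent w m (c * F) = 0 := by
  classical
  induction c using MvPolynomial.induction_on' with
  | monomial s r =>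
    exact ((isWeightedHomogeneous_monomial w s r rfl).mul hF).weightedHomogeneousComponent_ne _
      (Ne.symm (hm _))
  | add p q hp hq => rw [add_mul, map_add, hp, hq, add_zero]

/-- Two algebra homomorphisms whose values at each variable differ by a factor depending
multiplicatively on its weight differ by such a factor on weighted homogeneous polynomials. -/
theorem map_eq_map_mul_of_isWeightedHomogeneous {S : Type*} [CommRing S] [Algebra R S]
    [AddCommMonoid M] {w : σ → M} {P : MvPolynomial σ R} {m : M}
    (hP : IsWeightedHomogeneous w P m) (φ χ : MvPolynomial σ R →ₐ[R] S)
    (e : Multiplicative M →* S)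
    (h : ∀ v, φ (X v) = χ (X v) * e (Multiplicative.ofAdd (w v))) :
    φ P = χ P * e (Multiplicative.ofAdd m) := by
  classical
  have key : ∀ (s : σ →₀ ℕ) (r : R), φ (monomial s r) =
      χ (monomial s r) * e (Multiplicative.ofAdd (Finsupp.weight w s)) := by
    intro s r
    induction s using Finsupp.induction_linear generalizing r with
    | zero =>
      simp only [map_zero, ofAdd_zero, map_one, mul_one]
      rw [← C_apply, ← algebraMap_eq, AlgHom.commutes, AlgHom.commutes]
    | add s t hs ht =>
      have : monomial (s + t) r = monomial s r * monomial t (1 : R) := by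
        rw [monomial_mul, mul_one]
      rw [this, map_mul, map_mul, hs, ht, map_add, ofAdd_add, map_mul]
      ring
    | single v k =>
      have : monomial (Finsupp.single v k) r = C r * X v ^ k := by
        rw [C_mul_X_pow_eq_monomial]
      rw [this, map_mul, map_mul, map_pow, map_pow, h, mul_pow, Finsupp.weight_single,
        ofAdd_nsmul, map_pow, ← algebraMap_eq, AlgHom.commutes, AlgHom.commutes]
      ring
  rw [P.as_sum, map_sum, map_sum, Finset.sum_mul]
  refine Finset.sum_congr rfl fun s hs => ?_
  rw [key, hP (mem_support_iff.1 hs)]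

end WeightedHomogeneous

/-! ### Binary forms as finite-dimensional spaces. -/

section BinaryForms

variable {𝕜 : Type*} [Field 𝕜]

theorem coeff_X_pow_mul_X_pow (i j : ℕ) (s : Fin 2 →₀ ℕ) :
    coeff s (X 0 ^ i * X 1 ^ j : RT 𝕜) = if i = s 0 ∧ j = s 1 then 1 else 0 := by
  classical
  have : (X 0 ^ i * X 1 ^ j : RT 𝕜) =
      monomial (Finsupp.single 0 i + Finsupp.single 1 j) 1 := by
    rw [X_pow_eq_monomial, X_pow_eq_monomial, monomial_mul, mul_one]
  rw [this, coeff_monomial]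
  congr 1
  rw [Finsupp.ext_iff, Fin.forall_fin_two]
  simp

/-- The binary form `∑ i, c_i T₀^(k-1-i) T₁^i` with `k` given coefficients; it is of degree
`k - 1`, and zero if `k = 0`. -/
noncomputable def binaryForm (𝕜 : Type*) [Field 𝕜] (k : ℕ) : (Fin k → 𝕜) →ₗ[𝕜] RT 𝕜 :=
  Fintype.linearCombination 𝕜 fun i : Fin k => (X 0 ^ (k - 1 - i : ℕ) * X 1 ^ (i : ℕ) : RT 𝕜)

theorem binaryForm_apply (k : ℕ) (c : Fin k → 𝕜) :
    binaryForm 𝕜 k c = ∑ i : Fin k, C (c i) * (X 0 ^ (k - 1 - i : ℕ) * X 1 ^ (i : ℕ)) := by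
  simp [binaryForm, Fintype.linearCombination_apply, smul_eq_C_mul]

theorem coeff_binaryForm (k : ℕ) (c : Fin k → 𝕜) (i : Fin k) :
    coeff (Finsupp.single 0 (k - 1 - i : ℕ) + Finsupp.single 1 (i : ℕ)) (binaryForm 𝕜 k c)
      = c i := by
  classical
  rw [binaryForm_apply, coeff_sum, Finset.sum_eq_single i]
  · rw [coeff_C_mul, coeff_X_pow_mul_X_pow]
    simp
  · intro j _ hj
    rw [coeff_C_mul, coeff_X_pow_mul_X_pow, if_neg, mul_zero]
    simp only [Finsupp.add_apply]
    simp only [Finsupp.single_apply]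
    simp
    intro _ h
    exact hj (Fin.ext h)
  · simp

theorem binaryForm_injective (k : ℕ) : Function.Injective (binaryForm 𝕜 k) := by
  intro c c' h
  funext i
  rw [← coeff_binaryForm k c i, h, coeff_binaryForm]

theorem isHomogeneous_binaryForm (m : ℕ) (c : Fin (m + 1) → 𝕜) :
    (binaryForm 𝕜 (m + 1) c).IsHomogeneous m := by
  rw [binaryForm_apply]
  refine IsHomogeneous.sum _ _ _ fun i _ => ?_
  have h := (((isHomogeneous_X_pow (R := 𝕜) (0 : Fin 2) (m + 1 - 1 - i : ℕ)).mul
    (isHomogeneous_X_pow (R := 𝕜) (1 : Fin 2) (i : ℕ)))).C_mul (c i)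
  convert h using 1
  have := i.2
  omega

theorem eq_sum_coeffT {m : ℕ} {P : RT 𝕜} (hP : P.IsHomogeneous m) :
    P = ∑ k, C (coeffT m P k) * monT m k := by
  classical
  ext s
  simp only [coeff_sum, coeff_C_mul, monT, coeff_X_pow_mul_X_pow]
  by_cases hs : s 0 + s 1 = m
  · rw [Finset.sum_eq_single (⟨s 1, by omega⟩ : Fin (m + 1))]
    · rw [if_pos ⟨by simp; omega, rfl⟩, mul_one, coeffT]
      congr 1
      ext i
      fin_cases i
      · simp; omega
      · simp
    · intro k _ hk
      rw [if_neg, mul_zero]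
      rintro ⟨-, h⟩
      exact hk (Fin.ext h)
    · simp
  · have h0 : coeff s P = 0 := hP.coeff_eq_zero (by
      rw [Finsupp.degree_eq_sum]; simpa [Fin.sum_univ_two] using hs)
    rw [h0, Finset.sum_eq_zero]
    intro k _
    rw [if_neg, mul_zero]
    have := k.2
    omega

theorem exists_binaryForm_eq {m : ℕ} {P : RT 𝕜} (hP : P.IsHomogeneous m) :
    ∃ c, binaryForm 𝕜 (m + 1) c = P := by
  refine ⟨coeffT m P, ?_⟩
  conv_rhs => rw [eq_sum_coeffT hP]
  rw [binaryForm_apply]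
  rfl

/-- The coefficients depend on `u` alone, so one vector serves all three coordinates of a syzygy. If
`m < e`, the truncated `m + 1 - e` is `0` and so is the form. -/
theorem exists_homogeneousComponent_mul_eq (e m : ℕ) (u : RT 𝕜) :
    ∃ c : Fin (m + 1 - e) → 𝕜, ∀ {F : RT 𝕜}, F.IsHomogeneous e →
      homogeneousComponent m (u * F) = binaryForm 𝕜 (m + 1 - e) c * F := by
  by_cases hm : e ≤ m
  · obtain ⟨c, hc⟩ := exists_binaryForm_eq (homogeneousComponent_isHomogeneous (m - e) u)
    obtain ⟨k, hk⟩ : ∃ k, k = m + 1 - e := ⟨_, rfl⟩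
    rw [← hk]
    obtain rfl : m - e + 1 = k := by omega
    refine ⟨c, fun {F} hF => ?_⟩
    have := weightedHomogeneousComponent_mul_of_isWeightedHomogeneous hF u (m - e)
    rw [Nat.sub_add_cancel hm] at this
    rw [hc]
    exact this
  · refine ⟨0, fun {F} hF => ?_⟩
    rw [map_zero, zero_mul]
    exact weightedHomogeneousComponent_mul_eq_zero hF u (by omega)

end BinaryForms

/-! ### Saturation degree of the ideal of `p`. -/

section Saturation

variable {𝕜 : Type*} [Field 𝕜]

/-- If `A, B` is a basis of the syzygies of `p`, every form of degree at least `μ + μ₂ - 1` lies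
in the ideal of `p`, with homogeneous coefficients. -/
theorem exists_isHomogeneous_combination {p A B : Fin 3 → RT 𝕜} {μ₁ μ₂ : ℕ}
    (hp : ∀ l, (p l).IsHomogeneous (μ₁ + μ₂)) (hAB : IsMuBasis p A B μ₁ μ₂)
    {N : ℕ} (hN : μ₂ ≤ N + 1) {g : RT 𝕜} (hg : g.IsHomogeneous (N + (μ₁ + μ₂))) :
    ∃ h : Fin 3 → RT 𝕜, (∀ l, (h l).IsHomogeneous N) ∧ g = ∑ l, p l * h l := by
  classical
  let J : (Fin 3 → Fin (N + 1) → 𝕜) →ₗ[𝕜] (Fin 3 → RT 𝕜) :=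
    LinearMap.pi fun l => (binaryForm 𝕜 (N + 1)).comp (LinearMap.proj l)
  have hJ : Function.Injective J := fun c c' h =>
    funext fun l => binaryForm_injective _ (congrFun h l)
  let L : (Fin 3 → Fin (N + 1) → 𝕜) →ₗ[𝕜] RT 𝕜 :=
    (((Fintype.linearCombination (RT 𝕜) p).restrictScalars 𝕜)).comp J
  have hL : ∀ c, L c = ∑ l, p l * binaryForm 𝕜 (N + 1) (c l) := by
    intro c
    simp [L, J, Fintype.linearCombination_apply, mul_comm]
  let M : ((Fin (N + 1 - μ₁) → 𝕜) × (Fin (N + 1 - μ₂) → 𝕜)) →ₗ[𝕜] (Fin 3 → RT 𝕜) :=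
    LinearMap.pi fun l =>
      ((LinearMap.mulRight 𝕜 (A l)).comp (binaryForm 𝕜 _)).coprod
        ((LinearMap.mulRight 𝕜 (B l)).comp (binaryForm 𝕜 _))
  -- A syzygy of degree `N` is `u A + v B`; taking components of degree `N` makes `u, v` forms of
  -- degrees `N - μ₁`, `N - μ₂`, which bounds the kernel.
  have hker : (LinearMap.ker L).map J ≤ LinearMap.range M := by
    rintro _ ⟨c, hc, rfl⟩
    have hs : J c ∈ syzygies p := hc
    rw [← hAB.span_eq, Submodule.mem_span_pair] at hs
    obtain ⟨u, v, huv⟩ := hs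
    obtain ⟨cu, hu⟩ := exists_homogeneousComponent_mul_eq μ₁ N u
    obtain ⟨cv, hv⟩ := exists_homogeneousComponent_mul_eq μ₂ N v
    refine ⟨(cu, cv), funext fun l => ?_⟩
    have h1 : J c l = homogeneousComponent N (J c l) :=
      (homogeneousComponent_eq_self (isHomogeneous_binaryForm N (c l))).symm
    rw [h1, ← huv, Pi.add_apply, Pi.smul_apply, Pi.smul_apply, smul_eq_mul, smul_eq_mul, map_add,
      hu (hAB.homogeneous_fst l), hv (hAB.homogeneous_snd l)]
    simp [M]
  have h1 : Module.finrank 𝕜 (LinearMap.ker L) ≤ (N + 1 - μ₁) + (N + 1 - μ₂) := by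
    rw [(Submodule.equivMapOfInjective J hJ _).finrank_eq]
    refine (Submodule.finrank_mono hker).trans ((LinearMap.finrank_range_le M).trans ?_)
    simp
  have h2 := LinearMap.finrank_range_add_finrank_ker L
  have h3 : Module.finrank 𝕜 (Fin 3 → Fin (N + 1) → 𝕜) = 3 * (N + 1) := by
    simp [Module.finrank_pi_fintype]
  have hle : LinearMap.range L ≤ LinearMap.range (binaryForm 𝕜 (N + (μ₁ + μ₂) + 1)) := by
    rintro _ ⟨c, rfl⟩
    refine exists_binaryForm_eq ?_
    rw [hL]
    refine IsHomogeneous.sum _ _ _ fun l _ => ?_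
    have h := (hp l).mul (isHomogeneous_binaryForm N (c l))
    rwa [add_comm _ N] at h
  have h4 : Module.finrank 𝕜 (LinearMap.range (binaryForm 𝕜 (N + (μ₁ + μ₂) + 1))) ≤
      N + (μ₁ + μ₂) + 1 := by
    refine (LinearMap.finrank_range_le _).trans ?_
    simp
  have h12 := hAB.le
  -- Since `μ₁ ≤ μ₂ ≤ N + 1`, no subtraction truncates, and the rank is at least `3(N+1) - (N+1-μ₁)
  -- - (N+1-μ₂) = N + μ₁ + μ₂ + 1`, the dimension of the target.
  have heq := Submodule.eq_of_le_of_finrank_le hle (by omega)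
  obtain ⟨c, hc⟩ := exists_binaryForm_eq hg
  have hmem : g ∈ LinearMap.range L := heq ▸ ⟨c, hc⟩
  obtain ⟨c, rfl⟩ := hmem
  exact ⟨fun l => binaryForm 𝕜 (N + 1) (c l), fun l => isHomogeneous_binaryForm N (c l), hL c⟩

end Saturation

/-! ### Graded kernels and graded Nakayama. -/

section MinimalGenerators

variable {𝕜 σ τ M N : Type*} [Field 𝕜]

theorem isWeightedHomogeneous_map_monomial [AddCommMonoid M] [AddCommMonoid N]
    {w : σ → M} {w' : τ → N} (e : M →+ N) (φ : MvPolynomial σ 𝕜 →ₐ[𝕜] MvPolynomial τ 𝕜)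
    (h : ∀ v, IsWeightedHomogeneous w' (φ (X v)) (e (w v))) (s : σ →₀ ℕ) (r : 𝕜) :
    IsWeightedHomogeneous w' (φ (monomial s r)) (e (Finsupp.weight w s)) := by
  induction s using Finsupp.induction_linear generalizing r with
  | zero =>
    rw [← C_apply, ← algebraMap_eq, AlgHom.commutes, map_zero, map_zero]
    exact isWeightedHomogeneous_C _ _
  | add s t hs ht =>
    have : monomial (s + t) r = monomial s r * monomial t (1 : 𝕜) := by
      rw [monomial_mul, mul_one]
    rw [this, map_mul, map_add, map_add]
    exact (hs r).mul (ht 1)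
  | single v k =>
    rw [← C_mul_X_pow_eq_monomial, map_mul, map_pow, ← algebraMap_eq, AlgHom.commutes,
      Finsupp.weight_single, map_nsmul]
    exact ((h v).pow k).C_mul r

/-- An algebra homomorphism which changes degrees by an injective homomorphism is compatible with
weighted homogeneous components. -/
theorem weightedHomogeneousComponent_map [AddCommMonoid M] [AddCommMonoid N]
    {w : σ → M} {w' : τ → N} (e : M →+ N) (he : Function.Injective e)
    (φ : MvPolynomial σ 𝕜 →ₐ[𝕜] MvPolynomial τ 𝕜)
    (h : ∀ v, IsWeightedHomogeneous w' (φ (X v)) (e (w v))) (m : M) (F : MvPolynomial σ 𝕜) :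
    weightedHomogeneousComponent w' (e m) (φ F) = φ (weightedHomogeneousComponent w m F) := by
  classical
  induction F using MvPolynomial.induction_on' with
  | monomial s r =>
    have h1 := isWeightedHomogeneous_map_monomial e φ h s r
    have h2 := isWeightedHomogeneous_monomial w s r rfl
    by_cases hs : Finsupp.weight w s = m
    · rw [← hs, h1.weightedHomogeneousComponent_same, h2.weightedHomogeneousComponent_same]
    · rw [h1.weightedHomogeneousComponent_ne _ fun h0 => hs (he h0.symm),
        h2.weightedHomogeneousComponent_ne _ (Ne.symm hs), map_zero]
  | add p q hp hq => simp only [map_add, hp, hq]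

theorem ker_eq_span_isWeightedHomogeneous [AddCommMonoid M] [AddCommMonoid N]
    {w : σ → M} {w' : τ → N} (e : M →+ N) (he : Function.Injective e)
    (φ : MvPolynomial σ 𝕜 →ₐ[𝕜] MvPolynomial τ 𝕜)
    (h : ∀ v, IsWeightedHomogeneous w' (φ (X v)) (e (w v))) :
    Ideal.span {F | F ∈ RingHom.ker φ ∧ ∃ m, IsWeightedHomogeneous w F m} = RingHom.ker φ := by
  apply le_antisymm
  · rw [Ideal.span_le]
    exact fun F hF => hF.1
  · intro F hF
    rw [← finsum_weightedHomogeneousComponent w F]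
    refine finsum_induction (fun x => x ∈ _) (zero_mem _) (fun _ _ => add_mem) fun m => ?_
    refine Ideal.subset_span ⟨?_, m, weightedHomogeneousComponent_isWeightedHomogeneous m F⟩
    rw [RingHom.mem_ker] at hF ⊢
    rw [← weightedHomogeneousComponent_map e he φ h, hF, map_zero]

theorem eq_C_of_isWeightedHomogeneous [AddCommMonoid M] {w : σ → M}
    (hw : ∀ s : σ →₀ ℕ, Finsupp.weight w s = 0 → s = 0) {c : MvPolynomial σ 𝕜} {n : M}
    (hc : IsWeightedHomogeneous w c n) (h0 : constantCoeff c ≠ 0) : c = C (constantCoeff c) := by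
  classical
  have hn : n = 0 := by
    rw [← hc (d := 0) h0, map_zero]
  ext s
  rw [coeff_C]
  split_ifs with hs
  · rw [← hs]; rfl
  · by_contra hne
    exact hs (hw s ((hc hne).trans hn)).symm

/-- Graded Nakayama: a homogeneous element of `J` outside `𝔪 J` belongs to a minimal system of
homogeneous generators of `J`. -/
theorem exists_minimal_generators [AddCancelCommMonoid M] [Finite σ] {w : σ → M}
    (hw : ∀ s : σ →₀ ℕ, Finsupp.weight w s = 0 → s = 0) {J : Ideal (MvPolynomial σ 𝕜)}
    (hJ : Ideal.span {F | F ∈ J ∧ ∃ m, IsWeightedHomogeneous w F m} = J)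
    {G : MvPolynomial σ 𝕜} {m : M} (hG : IsWeightedHomogeneous w G m) (hGJ : G ∈ J)
    (hGm : G ∉ RingHom.ker (constantCoeff : MvPolynomial σ 𝕜 →+* 𝕜) * J) :
    ∃ s : Set (MvPolynomial σ 𝕜), (∀ F ∈ s, ∃ m, IsWeightedHomogeneous w F m) ∧
      Ideal.span s = J ∧ (∀ F ∈ s, F ∉ Ideal.span (s \ {F})) ∧ G ∈ s := by
  classical
  obtain ⟨t, ht, htJ⟩ := (Submodule.fg_span_iff_fg_span_finset_subset (R := MvPolynomial σ 𝕜)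
    {F | F ∈ J ∧ ∃ m, IsWeightedHomogeneous w F m}).1 (IsNoetherian.noetherian _)
  have htJ' : Ideal.span (t : Set (MvPolynomial σ 𝕜)) = J := by
    rw [← hJ]; exact htJ.symm
  -- Minimality is imposed only among finite homogeneous generating sets containing `G`; it shows
  -- that no element other than `G` is redundant. The redundancy of `G` itself is excluded by `hGm`.
  obtain ⟨s, ⟨hsh, hsJ, hGs⟩, hmin⟩ := (wellFounded_lt (α := Finset (MvPolynomial σ 𝕜))).has_min
    {s | (∀ F ∈ s, ∃ m, IsWeightedHomogeneous w F m) ∧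
      Ideal.span (s : Set (MvPolynomial σ 𝕜)) = J ∧ G ∈ s} ⟨insert G t, by
        refine ⟨?_, ?_, Finset.mem_insert_self _ _⟩
        · intro F hF
          rcases Finset.mem_insert.1 hF with rfl | hF
          · exact ⟨m, hG⟩
          · exact (ht hF).2
        · rw [Finset.coe_insert, Ideal.span_insert, htJ', sup_eq_right,
            Ideal.span_singleton_le_iff_mem]
          exact hGJ⟩
  have hne : ∀ F ∈ s, F ≠ G → F ∉ Ideal.span ((s : Set (MvPolynomial σ 𝕜)) \ {F}) := by
    intro F hF hFG hFs
    refine hmin (s.erase F) ⟨fun E hE => hsh E (Finset.mem_of_mem_erase hE), ?_,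
      Finset.mem_erase.2 ⟨hFG.symm, hGs⟩⟩ (Finset.erase_ssubset hF)
    rw [Finset.coe_erase]
    refine le_antisymm ((Ideal.span_mono Set.sdiff_subset).trans hsJ.le) ?_
    rw [← hsJ, Ideal.span_le]
    intro E hE
    by_cases hEF : E = F
    · rw [hEF]; exact hFs
    · exact Ideal.subset_span ⟨hE, hEF⟩
  refine ⟨s, hsh, hsJ, fun F hF => ?_, hGs⟩
  by_cases hFG : F = G
  swap
  · exact hne F hF hFG
  subst hFG
  intro hFs
  rw [← Finset.coe_erase, Ideal.span, Submodule.mem_span_finset] at hFs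
  obtain ⟨c, -, hc⟩ := hFs
  have hcomp : ∀ E ∈ s.erase F, ∃ c' : MvPolynomial σ 𝕜,
      weightedHomogeneousComponent w m (c E * E) = c' * E ∧
        (constantCoeff c' ≠ 0 → c' = C (constantCoeff c')) := by
    intro E hE
    obtain ⟨e, he⟩ := hsh E (Finset.mem_of_mem_erase hE)
    by_cases hm : ∃ n, n + e = m
    · obtain ⟨n, rfl⟩ := hm
      exact ⟨_, weightedHomogeneousComponent_mul_of_isWeightedHomogeneous he _ _,
        eq_C_of_isWeightedHomogeneous hw (weightedHomogeneousComponent_isWeightedHomogeneous n _)⟩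
    · refine ⟨0, ?_, fun h => absurd (map_zero _) h⟩
      rw [zero_mul]
      exact weightedHomogeneousComponent_mul_eq_zero he _ (not_exists.1 hm)
  choose! c' hc' hc0 using hcomp
  have hsum : F = ∑ E ∈ s.erase F, c' E * E := by
    conv_lhs => rw [← hG.weightedHomogeneousComponent_same, ← hc, map_sum]
    exact Finset.sum_congr rfl fun E hE => hc' E hE
  -- Either all coefficients lie in `𝔪`, putting `G` in `𝔪 J`, or some coefficient is a nonzero
  -- scalar and the relation can be solved for its generator, contradicting `hne`.
  by_cases hall : ∀ E ∈ s.erase F, constantCoeff (c' E) = 0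
  · apply hGm
    rw [hsum]
    refine sum_mem fun E hE => Ideal.mul_mem_mul (hall E hE) ?_
    rw [← hsJ]
    exact Ideal.subset_span (Finset.mem_of_mem_erase hE)
  · push Not at hall
    obtain ⟨E, hE, hE0⟩ := hall
    have hEs := Finset.mem_of_mem_erase hE
    have hEF := Finset.ne_of_mem_erase hE
    apply hne E hEs hEF
    have h1 : c' E * E ∈ Ideal.span ((s : Set (MvPolynomial σ 𝕜)) \ {E}) := by
      rw [← Finset.add_sum_erase _ _ hE, ← sub_eq_iff_eq_add] at hsum
      rw [← hsum]
      refine sub_mem (Ideal.subset_span ⟨hGs, Ne.symm hEF⟩) (sum_mem fun E' hE' => ?_)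
      refine Ideal.mul_mem_left _ _ (Ideal.subset_span ⟨?_, Finset.ne_of_mem_erase hE'⟩)
      exact Finset.mem_of_mem_erase (Finset.mem_of_mem_erase hE')
    have h2 := Ideal.mul_mem_left _ (C (constantCoeff (c' E))⁻¹) h1
    rw [← mul_assoc] at h2
    nth_rewrite 2 [hc0 E hE hE0] at h2
    rwa [← C_mul, inv_mul_cancel₀ hE0, C_1, one_mul] at h2

end MinimalGenerators

/-! ### Bigrading of the Rees ideal. -/

section ReesIdeal

variable {𝕜 : Type*} [Field 𝕜]

theorem isWeightedHomogeneous_incl {σ M : Type*} [AddCommMonoid M] {w : Fin 2 ⊕ σ → M} {e : M}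
    (hw : ∀ i, w (Sum.inl i) = e) {P : RT 𝕜} {n : ℕ} (hP : P.IsHomogeneous n) :
    IsWeightedHomogeneous w (incl P : MvPolynomial (Fin 2 ⊕ σ) 𝕜) (n • e) := by
  rw [P.as_sum, map_sum]
  refine IsWeightedHomogeneous.sum _ _ _ fun s hs => ?_
  have h := isWeightedHomogeneous_map_monomial (w := (1 : Fin 2 → ℕ)) (w' := w)
    (multiplesHom M e) (incl (σ := σ) (𝕜 := 𝕜)) (fun v => by
      simpa [incl, hw] using isWeightedHomogeneous_X 𝕜 w (Sum.inl v)) s (coeff s P)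
  rwa [hP (mem_support_iff.1 hs)] at h

theorem idealK_eq_span {f : Fin 3 → RT 𝕜} {d : ℕ} (hf : ∀ i, (f i).IsHomogeneous d) :
    Ideal.span {F | F ∈ idealK f ∧ ∃ m : ℕ × ℕ, IsBihomogeneous F m.1 m.2} = idealK f := by
  -- `Z_j ↦ f_j s` turns bidegree `(i, j)` into `(i + d j, j)`, an injective change of degrees.
  let e : ℕ × ℕ →+ ℕ × ℕ :=
    { toFun := fun m => (m.1 + d * m.2, m.2)
      map_zero' := by simp
      map_add' := fun m n => by ext <;> simp; ring }
  have he : Function.Injective e := by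
    rintro ⟨a, b⟩ ⟨a', b'⟩ h
    simp only [e, AddMonoidHom.coe_mk, ZeroHom.coe_mk, Prod.mk.injEq] at h
    obtain ⟨h1, rfl⟩ := h
    simpa using h1
  refine ker_eq_span_isWeightedHomogeneous
    (w' := (Sum.elim (fun _ => (1, 0)) (fun _ => (0, 1)) : Fin 2 ⊕ Unit → ℕ × ℕ)) e he (psi f) ?_
  rintro (i | j)
  · simpa [psi, e] using isWeightedHomogeneous_X 𝕜
      (Sum.elim (fun _ => (1, 0)) (fun _ => (0, 1)) : Fin 2 ⊕ Unit → ℕ × ℕ) (Sum.inl i)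
  · have h := (isWeightedHomogeneous_incl (σ := Unit)
      (w := (Sum.elim (fun _ => (1, 0)) (fun _ => (0, 1)) : Fin 2 ⊕ Unit → ℕ × ℕ))
      (fun _ => rfl) (hf j)).mul (isWeightedHomogeneous_X 𝕜 _ (Sum.inr ()))
    simpa [psi, e] using h

theorem isMinimalGenerator_of_notMem {f : Fin 3 → RT 𝕜} {d : ℕ} (hf : ∀ i, (f i).IsHomogeneous d)
    {G : RTZ 𝕜} {i j : ℕ} (hG : IsBihomogeneous G i j) (hGK : G ∈ idealK f)
    (hGm : G ∉ RingHom.ker (constantCoeff : RTZ 𝕜 →+* 𝕜) * idealK f) :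
    IsMinimalGenerator (idealK f) G := by
  obtain ⟨s, hs, hsK, hmin, hGs⟩ := exists_minimal_generators (fun s hs => by
      rw [Finsupp.weight_apply, Finsupp.sum_fintype _ _ (by simp), Prod.ext_iff] at hs
      simp [Prod.fst_sum, Prod.snd_sum] at hs
      ext v
      rcases v with v | v
      · fin_cases v <;> simp [hs]
      · fin_cases v <;> simp [hs]) (idealK_eq_span hf) hG hGK hGm
  exact ⟨s, fun F hF => (hs F hF).elim fun m h => ⟨m.1, m.2, h⟩, hsK, hmin, hGs⟩

end ReesIdeal

/-! ### The maps to `𝕜[T, X, Y]` and the operators there. -/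

section Parametrizations

variable {𝕜 : Type*} [Field 𝕜]

theorem map_incl {σ τ : Type*}
    (φ : MvPolynomial (Fin 2 ⊕ σ) 𝕜 →ₐ[𝕜] MvPolynomial (Fin 2 ⊕ τ) 𝕜)
    (h : ∀ i, φ (X (Sum.inl i)) = X (Sum.inl i)) (P : RT 𝕜) : φ (incl P) = incl P := by
  have : φ.comp incl = incl := by
    refine algHom_ext fun i => ?_
    simp [incl, h]
  exact DFunLike.congr_fun this P

theorem incl_injective {σ : Type*} :
    Function.Injective (incl : RT 𝕜 →ₐ[𝕜] MvPolynomial (Fin 2 ⊕ σ) 𝕜) :=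
  rename_injective _ Sum.inl_injective

/-- The composition `Φ' ∘ Γ`, sending `Z_j` to `A_j X + B_j Y`. -/
noncomputable def planeMap (μ₁ μ₂ : ℕ) (A B : Fin 3 → RT 𝕜) : RTZ 𝕜 →ₐ[𝕜] RTxy 𝕜 :=
  (PhiPrime 𝕜 μ₁ μ₂).comp (Gam μ₁ μ₂ A B)

/-- The map `𝕜[T, X, Y] → 𝕜[T, s]`, `X ↦ α s`, `Y ↦ β s`. -/
noncomputable def curveMap (α β : RT 𝕜) : RTxy 𝕜 →ₐ[𝕜] RTs 𝕜 :=
  aeval (Sum.elim (fun i => X (Sum.inl i)) ![incl α * X (Sum.inr ()), incl β * X (Sum.inr ())])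

/-- The equation `α Y - β X` of the curve `X = α s`, `Y = β s`. -/
noncomputable def curveEq (α β : RT 𝕜) : RTxy 𝕜 :=
  incl α * X (Sum.inr 1) - incl β * X (Sum.inr 0)

theorem planeMap_X_inl (μ₁ μ₂ : ℕ) (A B : Fin 3 → RT 𝕜) (i : Fin 2) :
    planeMap μ₁ μ₂ A B (X (Sum.inl i)) = X (Sum.inl i) := by
  simp [planeMap, Gam, PhiPrime]

theorem curveMap_X_inl (α β : RT 𝕜) (i : Fin 2) :
    curveMap α β (X (Sum.inl i)) = X (Sum.inl i) := by
  simp [curveMap]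

theorem planeMap_X_inr {μ₁ μ₂ : ℕ} {A B : Fin 3 → RT 𝕜} (hA : ∀ i, (A i).IsHomogeneous μ₁)
    (hB : ∀ i, (B i).IsHomogeneous μ₂) (j : Fin 3) :
    planeMap μ₁ μ₂ A B (X (Sum.inr j)) =
      incl (A j) * X (Sum.inr 0) + incl (B j) * X (Sum.inr 1) := by
  conv_rhs => rw [eq_sum_coeffT (hA j), eq_sum_coeffT (hB j)]
  have hC : ∀ c : 𝕜, incl (C c) = (C c : RTxy 𝕜) := fun c => by simp [incl]
  simp only [planeMap, AlgHom.comp_apply, Gam, PhiPrime, aeval_X, Sum.elim_inr, map_add, map_sum,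
    map_mul, Sum.elim_inl, algHom_C, algebraMap_eq, Finset.sum_mul, hC, mul_assoc]

/-- With `curveMap_comp_planeMap` this gives `Φ ∘ Γ = ψ` in the setting of the theorem, so that `Γ`
carries `𝓚` into `𝓘`. -/
theorem curveMap_comp_PhiPrime (μ₁ μ₂ : ℕ) (α β : RT 𝕜) :
    (curveMap α β).comp (PhiPrime 𝕜 μ₁ μ₂) = Phi μ₁ μ₂ α β := by
  refine algHom_ext ?_
  rintro (i | i | i)
  · simp [PhiPrime, Phi, curveMap]
  · simp only [AlgHom.comp_apply, PhiPrime, aeval_X, Sum.elim_inr, Sum.elim_inl, map_mul, Phi,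
      map_incl _ (curveMap_X_inl α β)]
    simp only [curveMap, aeval_X, Sum.elim_inr, Matrix.cons_val_zero]
    ring
  · simp only [AlgHom.comp_apply, PhiPrime, aeval_X, Sum.elim_inr, map_mul, Phi,
      map_incl _ (curveMap_X_inl α β)]
    simp only [curveMap, aeval_X, Sum.elim_inr, Matrix.cons_val_one]
    simp only [Matrix.cons_val_fin_one]
    ring

theorem curveMap_comp_planeMap {μ₁ μ₂ : ℕ} {f A B : Fin 3 → RT 𝕜} {α β : RT 𝕜}
    (hA : ∀ i, (A i).IsHomogeneous μ₁) (hB : ∀ i, (B i).IsHomogeneous μ₂)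
    (hdec : ∀ i, f i = α * A i + β * B i) :
    (curveMap α β).comp (planeMap μ₁ μ₂ A B) = psi f := by
  refine algHom_ext ?_
  rintro (i | j)
  · simp [planeMap_X_inl, curveMap_X_inl, psi]
  · rw [AlgHom.comp_apply, planeMap_X_inr hA hB, map_add, map_mul, map_mul,
      map_incl _ (curveMap_X_inl α β), map_incl _ (curveMap_X_inl α β)]
    simp only [curveMap, psi, aeval_X, Sum.elim_inr, hdec, map_add, map_mul]
    simp
    ring

theorem curveMap_curveEq (α β : RT 𝕜) : curveMap α β (curveEq α β) = 0 := by
  rw [curveEq, map_sub, map_mul, map_mul, map_incl _ (curveMap_X_inl α β),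
    map_incl _ (curveMap_X_inl α β)]
  simp [curveMap]
  ring

/-! ### Effect of the operators -/

section Operators

variable {μ₁ μ₂ : ℕ} {p A B : Fin 3 → RT 𝕜} {F G : RTZ 𝕜}

/-- The determinant is `H · (Z × C)`. For `Z = A X + B Y` the cross product is `X p` when `C = B`
and `-Y p` when `C = A`, so only `∑ p_ℓ H_ℓ = F` matters. -/
theorem planeMap_det (hA : ∀ i, (A i).IsHomogeneous μ₁) (hB : ∀ i, (B i).IsHomogeneous μ₂)
    (hpAB : p = A ⨯₃ B) {C : Fin 3 → RT 𝕜} {c : RTxy 𝕜}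
    (hC : (C = B ∧ c = X (Sum.inr 0)) ∨ (C = A ∧ c = -X (Sum.inr 1)))
    (h : IsDValue p C F G) : planeMap μ₁ μ₂ A B G = c * planeMap μ₁ μ₂ A B F := by
  obtain ⟨H, -, rfl, rfl⟩ := h
  have hi := map_incl _ (planeMap_X_inl μ₁ μ₂ A B)
  subst hpAB
  rcases hC with ⟨rfl, rfl⟩ | ⟨rfl, rfl⟩ <;>
  · simp only [Matrix.det_fin_three, Fin.sum_univ_three, cross_apply, Matrix.of_apply,
      Matrix.cons_val', Matrix.cons_val_zero, Matrix.cons_val_one, Matrix.cons_val, map_sub,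
      map_add, map_mul, hi, planeMap_X_inr hA hB]
    ring

theorem isBihomogeneous_of_isDValue {m n i j : ℕ} (hp : ∀ l, (p l).IsHomogeneous m)
    {C : Fin 3 → RT 𝕜} (hC : ∀ l, (C l).IsHomogeneous n) (hF : IsBihomogeneous F i j)
    (hF0 : F ≠ 0) (h : IsDValue p C F G) :
    ∃ k, k + m = i ∧ IsBihomogeneous G (k + n) (j + 1) := by
  obtain ⟨H, ⟨k, j', hH⟩, rfl, rfl⟩ := h
  have h1 : IsBihomogeneous (∑ l, incl (p l) * H l) (k + m) j' := by
    refine IsWeightedHomogeneous.sum _ _ _ fun l _ => ?_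
    have := (isWeightedHomogeneous_incl (w := (Sum.elim (fun _ => (1, 0)) (fun _ => (0, 1)) :
      Fin 2 ⊕ Fin 3 → ℕ × ℕ)) (fun _ => rfl) (hp l)).mul (hH l)
    convert this using 1
    ext <;> simp [add_comm]
  -- The unspecified common bidegree of the `H l` is forced by that of `F`, provided `F ≠ 0`.
  have h2 := IsWeightedHomogeneous.inj_right hF0 h1 hF
  simp only [Prod.mk.injEq] at h2
  obtain ⟨rfl, rfl⟩ := h2
  refine ⟨k, rfl, ?_⟩
  have hterm : ∀ l l' l'', IsBihomogeneous (H l * X (Sum.inr l') * incl (C l'')) (k + n)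
      (j' + 1) := by
    intro l l' l''
    have := ((hH l).mul (isWeightedHomogeneous_X 𝕜 _ (Sum.inr l'))).mul
      (isWeightedHomogeneous_incl (w := (Sum.elim (fun _ => (1, 0)) (fun _ => (0, 1)) :
      Fin 2 ⊕ Fin 3 → ℕ × ℕ)) (fun _ => rfl) (hC l''))
    unfold IsBihomogeneous
    convert this using 1
    ext <;> simp
  rw [Matrix.det_fin_three]
  simp only [Matrix.of_apply, Matrix.cons_val', Matrix.cons_val_zero, Matrix.cons_val_one,
    Matrix.cons_val]
  exact (((((hterm 0 1 2).sub (hterm 0 2 1)).sub (hterm 1 0 2)).add (hterm 1 2 0)).add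
    (hterm 2 0 1)).sub (hterm 2 1 0)

/-- The operators are defined on bihomogeneous polynomials of large degree in `T`. -/
theorem exists_isDValue (hp : ∀ l, (p l).IsHomogeneous (μ₁ + μ₂)) (hAB : IsMuBasis p A B μ₁ μ₂)
    {i j : ℕ} (hi : μ₁ + 2 * μ₂ ≤ i + 1) (hF : IsBihomogeneous F i j) (hi' : μ₁ + μ₂ ≤ i)
    (V : Fin 3 → RT 𝕜) : ∃ G, IsDValue p V F G := by
  classical
  obtain ⟨N, rfl⟩ := Nat.exists_eq_add_of_le' hi'
  suffices ∃ H : Fin 3 → RTZ 𝕜, (∀ l, IsBihomogeneous (H l) N j) ∧ F = ∑ l, incl (p l) * H l by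
    obtain ⟨H, hH, hFH⟩ := this
    exact ⟨_, H, ⟨_, _, hH⟩, hFH, rfl⟩
  have hmono : ∀ s ∈ F.support, ∃ H : Fin 3 → RTZ 𝕜, (∀ l, IsBihomogeneous (H l) N j) ∧
      monomial s (coeff s F) = ∑ l, incl (p l) * H l := by
    intro s hs
    have hw := hF (mem_support_iff.1 hs)
    rw [Finsupp.weight_apply, Finsupp.sum_fintype _ _ (by simp), Prod.ext_iff] at hw
    simp [Fin.sum_univ_three] at hw
    obtain ⟨h, hh, hsum⟩ := exists_isHomogeneous_combination hp hAB (N := N) (by omega)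
      (g := X 0 ^ s (Sum.inl 0) * X 1 ^ s (Sum.inl 1)) (by
        rw [← hw.1]
        exact (isHomogeneous_X_pow _ _).mul (isHomogeneous_X_pow _ _))
    let Q : RTZ 𝕜 := X (Sum.inr 0) ^ s (Sum.inr 0) * X (Sum.inr 1) ^ s (Sum.inr 1) *
      X (Sum.inr 2) ^ s (Sum.inr 2)
    have hQ : IsBihomogeneous Q 0 j := by
      have := (((isWeightedHomogeneous_X 𝕜 (Sum.elim (fun _ => (1, 0)) (fun _ => (0, 1)) :
        Fin 2 ⊕ Fin 3 → ℕ × ℕ) (Sum.inr 0)).pow (s (Sum.inr 0))).mul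
        ((isWeightedHomogeneous_X 𝕜 _ (Sum.inr 1)).pow (s (Sum.inr 1)))).mul
        ((isWeightedHomogeneous_X 𝕜 _ (Sum.inr 2)).pow (s (Sum.inr 2)))
      unfold IsBihomogeneous
      convert this using 1
      ext
      · simp
      · simp [← hw.2]
    refine ⟨fun l => C (coeff s F) * (incl (h l) * Q), fun l => ?_, ?_⟩
    · have := ((isWeightedHomogeneous_incl (w := (Sum.elim (fun _ => (1, 0)) (fun _ => (0, 1)) :
        Fin 2 ⊕ Fin 3 → ℕ × ℕ)) (fun _ => rfl) (hh l)).mul hQ).C_mul (coeff s F)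
      unfold IsBihomogeneous
      convert this using 1
      ext <;> simp
    · have h1 : ∑ l, incl (p l) * (C (coeff s F) * (incl (h l) * Q)) =
          C (coeff s F) * (incl (∑ l, p l * h l) * Q) := by
        simp only [map_sum, map_mul, Finset.sum_mul, Finset.mul_sum]
        exact Finset.sum_congr rfl fun l _ => by ring
      rw [h1, ← hsum, monomial_eq, Finsupp.prod_fintype _ _ (by simp), Fintype.prod_sum_type,
        Fin.prod_univ_two, Fin.prod_univ_three]
      simp [incl, Q]
  choose! H hH hsum using hmono
  refine ⟨fun l => ∑ s ∈ F.support, H s l, fun l => ?_, ?_⟩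
  · exact IsWeightedHomogeneous.sum _ _ _ fun s hs => hH s hs l
  · conv_lhs => rw [F.as_sum]
    rw [Finset.sum_congr rfl hsum, Finset.sum_comm]
    simp only [Finset.mul_sum]

end Operators

end Parametrizations

/-! ### The image of `𝓚` and of `𝔪 𝓚`. -/

section CurveKernel

variable {𝕜 : Type*} [Field 𝕜]

/-- Substitution of constants for `X` and `Y`. -/
noncomputable def evalXY (c : Fin 2 → 𝕜) : RTxy 𝕜 →ₐ[𝕜] RT 𝕜 :=
  aeval (Sum.elim X fun i => C (c i))

theorem evalXY_incl (c : Fin 2 → 𝕜) (P : RT 𝕜) : evalXY c (incl P) = P := by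
  have : (evalXY c).comp incl = AlgHom.id 𝕜 (RT 𝕜) := by
    refine algHom_ext fun i => ?_
    simp [incl, evalXY]
  exact DFunLike.congr_fun this P

theorem evalXY_curveEq (α β : RT 𝕜) : evalXY ![0, 1] (curveEq α β) = α := by
  rw [curveEq, map_sub, map_mul, map_mul, evalXY_incl, evalXY_incl]
  simp [evalXY]

theorem curveEq_ne_zero {α : RT 𝕜} (hα : α ≠ 0) (β : RT 𝕜) : curveEq α β ≠ 0 := fun h =>
  hα (by rw [← evalXY_curveEq α β, h, map_zero])

/-- A divisor of `β` is free of `X` and `Y`; setting `X = 0`, `Y = 1` then shows that it divides `α`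
as well. -/
theorem isRelPrime_incl_curveEq {α β : RT 𝕜} (hβ : β ≠ 0) (h : IsRelPrime α β) :
    IsRelPrime (incl β : RTxy 𝕜) (curveEq α β) := by
  intro c hc1 hc2
  obtain ⟨c', rfl⟩ : ∃ c', incl c' = c := by
    obtain ⟨e, he⟩ := hc1
    have hβ' : (incl β : RTxy 𝕜) ≠ 0 := fun h0 => hβ (incl_injective (by rw [h0, map_zero]))
    have hc0 : c ≠ 0 := by rintro rfl; exact hβ' (by rw [he, zero_mul])
    have he0 : e ≠ 0 := by rintro rfl; exact hβ' (by rw [he, mul_zero])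
    refine exists_rename_eq_of_vars_subset_range c Sum.inl Sum.inl_injective ?_
    rintro (i | i) hi
    · exact ⟨i, rfl⟩
    · exfalso
      have h1 : degreeOf (Sum.inr i) (incl β : RTxy 𝕜) = 0 := by
        classical
        by_contra h1
        have h2 := vars_rename Sum.inl β (mem_vars_iff_degreeOf_ne_zero.2 h1)
        simp at h2
      rw [he, degreeOf_mul_eq hc0 he0] at h1
      exact mem_vars_iff_degreeOf_ne_zero.1 hi (Nat.eq_zero_of_add_eq_zero_right h1)
  have h1 := map_dvd (evalXY ![0, 1]) hc1
  have h2 := map_dvd (evalXY ![0, 1]) hc2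
  rw [evalXY_incl, evalXY_incl] at h1
  rw [evalXY_incl, evalXY_curveEq] at h2
  exact (h h2 h1).map incl

variable {μ₁ μ₂ : ℕ} {f A B : Fin 3 → RT 𝕜} {α β : RT 𝕜}

/-- Modulo `α Y - β X` one has `f_k Y ≡ β (A_k X + B_k Y)`. In `Z`-degree `j` this makes `ψ(F)` at
`s = Y`, which is `0`, congruent to `β^j` times the image of `F`, and `β` is prime to `α Y - β X`.
-/
theorem curveEq_dvd_planeMap_of_isBihomogeneous (hA : ∀ i, (A i).IsHomogeneous μ₁)
    (hB : ∀ i, (B i).IsHomogeneous μ₂) (hdec : ∀ i, f i = α * A i + β * B i) (hβ : β ≠ 0)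
    (hαβ : IsRelPrime α β) {F : RTZ 𝕜} {i j : ℕ} (hF : IsBihomogeneous F i j)
    (hFK : F ∈ idealK f) : curveEq α β ∣ planeMap μ₁ μ₂ A B F := by
  let π := Ideal.Quotient.mkₐ 𝕜 (Ideal.span {curveEq α β})
  have hπ : ∀ x, π x = 0 ↔ curveEq α β ∣ x := fun x => by
    rw [← Ideal.mem_span_singleton, ← Ideal.Quotient.eq_zero_iff_mem]
    rfl
  let ρ : RTs 𝕜 →ₐ[𝕜] RTxy 𝕜 := aeval (Sum.elim (fun i => X (Sum.inl i)) fun _ => X (Sum.inr 1))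
  have hρ : ∀ P, ρ (incl P) = incl P := map_incl ρ fun i => by simp [ρ]
  let e : Multiplicative (ℕ × ℕ) →* (RTxy 𝕜 ⧸ Ideal.span {curveEq α β}) :=
    { toFun := fun m => π (incl β) ^ m.toAdd.2
      map_one' := by simp
      map_mul' := fun m n => by simp [pow_add] }
  have hscale := map_eq_map_mul_of_isWeightedHomogeneous hF (π.comp (ρ.comp (psi f))) (π.comp (planeMap μ₁ μ₂ A B)) e (by
    rintro (k | k)
    · simp [psi, planeMap_X_inl, ρ, e]
    · rw [AlgHom.comp_apply, AlgHom.comp_apply, AlgHom.comp_apply, planeMap_X_inr hA hB]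
      have he : e (Multiplicative.ofAdd ((0, 1) : ℕ × ℕ)) = π (incl β) := by simp [e]
      have hψ : ρ (psi f (X (Sum.inr k))) = incl (f k) * X (Sum.inr 1) := by
        simp only [psi, aeval_X, Sum.elim_inr, map_mul, hρ]
        simp [ρ]
      rw [Sum.elim_inr, he, hψ, ← map_mul, ← sub_eq_zero, ← map_sub, hπ]
      refine ⟨incl (A k), ?_⟩
      rw [hdec, curveEq, map_add, map_mul, map_mul]
      ring)
  have h0 : psi f F = 0 := hFK
  have he : e (Multiplicative.ofAdd (i, j)) = π (incl β ^ j) := by simp [e]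
  rw [AlgHom.comp_apply, AlgHom.comp_apply, AlgHom.comp_apply, h0, map_zero, map_zero, he,
    ← map_mul, eq_comm, hπ] at hscale
  exact IsRelPrime.dvd_of_dvd_mul_right
    ((isRelPrime_incl_curveEq hβ hαβ).pow_left (m := j)).symm hscale

theorem curveEq_dvd_planeMap {d : ℕ} (hf : ∀ i, (f i).IsHomogeneous d)
    (hA : ∀ i, (A i).IsHomogeneous μ₁)
    (hB : ∀ i, (B i).IsHomogeneous μ₂) (hdec : ∀ i, f i = α * A i + β * B i) (hβ : β ≠ 0)
    (hαβ : IsRelPrime α β) {F : RTZ 𝕜} (hFK : F ∈ idealK f) :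
    curveEq α β ∣ planeMap μ₁ μ₂ A B F := by
  rw [← Ideal.mem_span_singleton, ← RingHom.coe_coe, ← Ideal.mem_comap]
  revert hFK F
  change idealK f ≤ _
  rw [← idealK_eq_span hf, Ideal.span_le]
  rintro F ⟨hF, m, hm⟩
  exact Ideal.mem_span_singleton.2
    (curveEq_dvd_planeMap_of_isBihomogeneous hA hB hdec hβ hαβ hm hF)

/-- Substitution of `0` for `T₀` and `T₁`. -/
noncomputable def evalT (𝕜 : Type*) [Field 𝕜] : RTxy 𝕜 →ₐ[𝕜] RTxy 𝕜 :=
  aeval (Sum.elim 0 fun i => X (Sum.inr i))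

theorem evalT_incl {P : RT 𝕜} {n : ℕ} (hP : P.IsHomogeneous n) (hn : 0 < n) :
    evalT 𝕜 (incl P) = 0 := by
  have : (evalT 𝕜).comp incl = aeval (0 : Fin 2 → RTxy 𝕜) := by
    refine algHom_ext fun i => ?_
    simp [incl, evalT]
  rw [← AlgHom.comp_apply, this, aeval_zero, show constantCoeff P = 0 from
    hP.coeff_eq_zero (by simpa using hn.ne), map_zero]

theorem evalT_planeMap (hA : ∀ i, (A i).IsHomogeneous μ₁) (hB : ∀ i, (B i).IsHomogeneous μ₂)
    (h₁ : 0 < μ₁) (h₂ : 0 < μ₂) (F : RTZ 𝕜) :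
    evalT 𝕜 (planeMap μ₁ μ₂ A B F) = algebraMap 𝕜 _ (constantCoeff F) := by
  have : (evalT 𝕜).comp (planeMap μ₁ μ₂ A B) = aeval (0 : Fin 2 ⊕ Fin 3 → RTxy 𝕜) := by
    refine algHom_ext ?_
    rintro (i | j)
    · simp [planeMap_X_inl, evalT]
    · rw [AlgHom.comp_apply, planeMap_X_inr hA hB, map_add, map_mul, map_mul,
        evalT_incl (hA j) h₁, evalT_incl (hB j) h₂]
      simp
  rw [← AlgHom.comp_apply, this, aeval_zero]

/-- The obstruction to lying in `𝔪 𝓚`: a factor from `𝔪` maps into `(T₀, T₁)`, since `A` and `B`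
have positive degree. -/
theorem exists_planeMap_eq_of_mem_mul {d : ℕ} (hf : ∀ i, (f i).IsHomogeneous d)
    (hA : ∀ i, (A i).IsHomogeneous μ₁) (hB : ∀ i, (B i).IsHomogeneous μ₂)
    (h₁ : 0 < μ₁) (h₂ : 0 < μ₂) (hdec : ∀ i, f i = α * A i + β * B i) (hβ : β ≠ 0)
    (hαβ : IsRelPrime α β) {G : RTZ 𝕜}
    (hG : G ∈ RingHom.ker (constantCoeff : RTZ 𝕜 →+* 𝕜) * idealK f) :
    ∃ g, planeMap μ₁ μ₂ A B G = curveEq α β * g ∧ evalT 𝕜 g = 0 := by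
  refine Submodule.mul_induction_on hG (fun c hc F hF => ?_) ?_
  · obtain ⟨g, hg⟩ := curveEq_dvd_planeMap hf hA hB hdec hβ hαβ hF
    refine ⟨planeMap μ₁ μ₂ A B c * g, by rw [map_mul, hg]; ring, ?_⟩
    rw [map_mul, evalT_planeMap hA hB h₁ h₂, (RingHom.mem_ker).1 hc, map_zero, zero_mul]
  · rintro x y ⟨g, hg, hg0⟩ ⟨g', hg', hg0'⟩
    exact ⟨g + g', by rw [map_add, hg, hg', mul_add], by rw [map_add, hg0, hg0', add_zero]⟩

end CurveKernel

/-! ### Trihomogeneous lifts and minimal generators of `S`. -/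

section Scroll

variable {𝕜 : Type*} [Field 𝕜]

theorem PhiPrime_of_isTrihomogeneous {μ₁ μ₂ : ℕ} {P : RTXY 𝕜 μ₁ μ₂} {i j k : ℕ}
    (hP : IsTrihomogeneous P i j k) :
    PhiPrime 𝕜 μ₁ μ₂ P =
      incl (specialize μ₁ μ₂ P) * (X (Sum.inr 0) ^ j * X (Sum.inr 1) ^ k) := by
  let e : Multiplicative (ℕ × ℕ × ℕ) →* RTxy 𝕜 :=
    { toFun := fun m => X (Sum.inr 0) ^ m.toAdd.2.1 * X (Sum.inr 1) ^ m.toAdd.2.2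
      map_one' := by simp
      map_mul' := fun m n => by simp [pow_add]; ring }
  have h := map_eq_map_mul_of_isWeightedHomogeneous hP (PhiPrime 𝕜 μ₁ μ₂) (incl.comp (specialize μ₁ μ₂)) e (by
    rintro (v | v | v)
    · simp [PhiPrime, specialize, e, incl]
    · simp [PhiPrime, specialize, e]
    · simp [PhiPrime, specialize, e])
  simpa [e] using h

theorem exists_mul_monT_eq {m u v : ℕ} (h : m ≤ u + v) : ∃ (k : Fin (m + 1)) (u' v' : ℕ),
    (X 0 ^ u * X 1 ^ v : RT 𝕜) = X 0 ^ u' * X 1 ^ v' * monT m k ∧ u' + v' + m = u + v := by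
  -- The factor of degree `m` takes as many copies of `T₀` as possible.
  refine ⟨⟨m - min u m, by omega⟩, u - min u m, v - (m - min u m), ?_, by omega⟩
  have hu : u = u - min u m + (m - (m - min u m)) := by omega
  have hv : v = v - (m - min u m) + (m - min u m) := by omega
  conv_lhs => rw [hu, hv]
  simp only [monT, pow_add]
  ring

theorem exists_isTrihomogeneous_specialize_monomial (μ₁ μ₂ : ℕ) {i j k u v : ℕ}
    (h : u + v = i + j * μ₁ + k * μ₂) : ∃ Q : RTXY 𝕜 μ₁ μ₂, IsTrihomogeneous Q i j k ∧
      specialize μ₁ μ₂ Q = X 0 ^ u * X 1 ^ v := by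
  induction k generalizing u v with
  | zero =>
    induction j generalizing u v with
    | zero =>
      refine ⟨X (Sum.inl 0) ^ u * X (Sum.inl 1) ^ v, ?_, by simp [specialize]⟩
      have := ((isWeightedHomogeneous_X 𝕜 (Sum.elim (fun _ => (1, 0, 0)) (Sum.elim
        (fun _ => (0, 1, 0)) (fun _ => (0, 0, 1))) :
        Fin 2 ⊕ (Fin (μ₁ + 1) ⊕ Fin (μ₂ + 1)) → ℕ × ℕ × ℕ) (Sum.inl 0)).pow u).mul
        ((isWeightedHomogeneous_X 𝕜 _ (Sum.inl 1)).pow v)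
      unfold IsTrihomogeneous
      convert this using 1
      simp
      omega
    | succ j ih =>
      rw [Nat.succ_mul] at h
      obtain ⟨n, u', v', huv, hsum⟩ := exists_mul_monT_eq (𝕜 := 𝕜) (show μ₁ ≤ u + v by omega)
      obtain ⟨Q, hQ, hQs⟩ := ih (u := u') (v := v') (by omega)
      refine ⟨Q * X (Sum.inr (Sum.inl n)), ?_, ?_⟩
      · have := hQ.mul (isWeightedHomogeneous_X 𝕜 _ (Sum.inr (Sum.inl n)))
        unfold IsTrihomogeneous
        convert this using 1
        simp
      · rw [map_mul, hQs, huv]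
        simp [specialize]
  | succ k ih =>
    rw [Nat.succ_mul] at h
    obtain ⟨n, u', v', huv, hsum⟩ := exists_mul_monT_eq (𝕜 := 𝕜) (show μ₂ ≤ u + v by omega)
    obtain ⟨Q, hQ, hQs⟩ := ih (u := u') (v := v') (by omega)
    refine ⟨Q * X (Sum.inr (Sum.inr n)), ?_, ?_⟩
    · have := hQ.mul (isWeightedHomogeneous_X 𝕜 _ (Sum.inr (Sum.inr n)))
      unfold IsTrihomogeneous
      convert this using 1
      simp
    · rw [map_mul, hQs, huv]
      simp [specialize]

theorem exists_isTrihomogeneous_specialize (μ₁ μ₂ : ℕ) {i j k n : ℕ} {P : RT 𝕜}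
    (hP : P.IsHomogeneous n) (hn : n = i + j * μ₁ + k * μ₂) :
    ∃ Q : RTXY 𝕜 μ₁ μ₂, IsTrihomogeneous Q i j k ∧ specialize μ₁ μ₂ Q = P := by
  have h : ∀ l : Fin (n + 1), ∃ Q : RTXY 𝕜 μ₁ μ₂, IsTrihomogeneous Q i j k ∧
      specialize μ₁ μ₂ Q = monT n l := fun l =>
    exists_isTrihomogeneous_specialize_monomial μ₁ μ₂ (by have := l.2; omega)
  choose Q hQ hQs using h
  refine ⟨∑ l, C (coeffT n P l) * Q l, IsWeightedHomogeneous.sum _ _ _ fun l _ =>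
    (hQ l).C_mul _, ?_⟩
  conv_rhs => rw [eq_sum_coeffT hP]
  simp [hQs, algHom_C]

/-- Substituting powers of one variable with exponents `1, μ₁, μ₂` turns membership into
divisibility by a power. -/
theorem le_of_monV_mem_idealS {μ₁ μ₂ d i j k : ℕ} (h : monV 𝕜 i j k ∈ idealS 𝕜 μ₁ μ₂ d) :
    d ≤ i + μ₁ * j + μ₂ * k + (μ₁ + μ₂) := by
  let φ : MvPolynomial (Fin 3) 𝕜 →ₐ[𝕜] Polynomial 𝕜 :=
    aeval ![Polynomial.X, Polynomial.X ^ μ₁, Polynomial.X ^ μ₂]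
  have hφ : ∀ i j k, φ (monV 𝕜 i j k) = Polynomial.X ^ (i + μ₁ * j + μ₂ * k) := by
    intro i j k
    simp [φ, monV, pow_add, pow_mul]
  have hle : idealS 𝕜 μ₁ μ₂ d ≤
      (Ideal.span {(Polynomial.X : Polynomial 𝕜) ^ (d - (μ₁ + μ₂))}).comap φ := by
    rw [idealS, Ideal.span_le]
    rintro _ ⟨i, j, k, hijk, rfl⟩
    rw [SetLike.mem_coe, Ideal.mem_comap, hφ, Ideal.mem_span_singleton]
    exact pow_dvd_pow _ (by omega)
  have := hle h
  rw [Ideal.mem_comap, hφ, Ideal.mem_span_singleton,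
    pow_dvd_pow_iff Polynomial.X_ne_zero Polynomial.not_isUnit_X] at this
  omega

/-- All weights are positive, so a proper divisor falls strictly below the bound. -/
theorem isMinGenS_of_eq {μ₁ μ₂ d i j k : ℕ} (h₁ : 0 < μ₁) (h₂ : 0 < μ₂)
    (h : i + μ₁ * j + μ₂ * k + (μ₁ + μ₂) = d) : IsMinGenS 𝕜 μ₁ μ₂ d i j k := by
  refine ⟨Ideal.subset_span ⟨i, j, k, h.ge, rfl⟩, fun i₁ j₁ k₁ hi hj hk hmem => ?_⟩
  have := le_of_monV_mem_idealS hmem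
  have hj' := Nat.mul_le_mul_left μ₁ hj
  have hk' := Nat.mul_le_mul_left μ₂ hk
  exact ⟨by omega, Nat.eq_of_mul_eq_mul_left h₁ (by omega),
    Nat.eq_of_mul_eq_mul_left h₂ (by omega)⟩

theorem IsIterate.trans {p A B : Fin 3 → RT 𝕜} {a b a' b' : ℕ} {F G H : RTZ 𝕜}
    (h : IsIterate p A B a b F G) (h' : IsIterate p A B a' b' G H) :
    IsIterate p A B (a + a') (b + b') F H := by
  induction h' with
  | refl => exact h
  | stepA _ hD ih => exact (ih h).stepA hD
  | stepB _ hD ih => exact (ih h).stepB hD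

end Scroll

/-! ### Iterates of the operators, and the generators `Ψ⁰`. -/

section Iterates

variable {𝕜 : Type*} [Field 𝕜] {d μ μ₁ μ₂ : ℕ} {f p q A B : Fin 3 → RT 𝕜} {α β : RT 𝕜}

theorem not_isUnit_of_isHomogeneous {P : RT 𝕜} {n : ℕ} (hP : P.IsHomogeneous n) (hn : 0 < n) :
    ¬ IsUnit P := fun h => by
  have h0 : constantCoeff P = 0 := hP.coeff_eq_zero (by simpa using hn.ne)
  exact not_isUnit_zero (h0 ▸ h.map (constantCoeff : RT 𝕜 →+* 𝕜))

/-- The triple product gives `(A × B) × q = (A·q) B - (B·q) A`; compare coefficients along the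
independent `A, B`. -/
theorem decomposition_eq (hAB : IsMuBasis p A B μ₁ μ₂) (hfpq : f = p ⨯₃ q) (hpAB : p = A ⨯₃ B)
    (hdec : ∀ i, f i = α * A i + β * B i) :
    α = -(B 0 * q 0 + B 1 * q 1 + B 2 * q 2) ∧ β = A 0 * q 0 + A 1 * q 1 + A 2 * q 2 := by
  have h := LinearIndependent.pair_iff.1 hAB.linearIndependent
    (α + (B 0 * q 0 + B 1 * q 1 + B 2 * q 2)) (β - (A 0 * q 0 + A 1 * q 1 + A 2 * q 2)) (by
      funext i
      have hi := hdec i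
      rw [hfpq, hpAB] at hi
      simp only [Pi.add_apply, Pi.smul_apply, smul_eq_mul, Pi.zero_apply]
      fin_cases i <;> simp [cross_apply] at hi ⊢ <;> linear_combination -hi)
  exact ⟨eq_neg_of_add_eq_zero_left h.1, sub_eq_zero.1 h.2⟩

theorem planeMap_movingLine (hAB : IsMuBasis p A B μ₁ μ₂) (hfpq : f = p ⨯₃ q)
    (hpAB : p = A ⨯₃ B) (hdec : ∀ i, f i = α * A i + β * B i) :
    planeMap μ₁ μ₂ A B (movingLine q) = -curveEq α β := by
  obtain ⟨rfl, rfl⟩ := decomposition_eq hAB hfpq hpAB hdec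
  simp only [movingLine, Fin.sum_univ_three, curveEq, map_add, map_mul, map_neg,
    map_incl _ (planeMap_X_inl μ₁ μ₂ A B),
    planeMap_X_inr hAB.homogeneous_fst hAB.homogeneous_snd]
  ring

theorem isBihomogeneous_movingLine {n : ℕ} (hq : ∀ i, (q i).IsHomogeneous n) :
    IsBihomogeneous (movingLine q) n 1 := by
  refine IsWeightedHomogeneous.sum _ _ _ fun j _ => ?_
  have := (isWeightedHomogeneous_incl (w := (Sum.elim (fun _ => (1, 0)) (fun _ => (0, 1)) :
    Fin 2 ⊕ Fin 3 → ℕ × ℕ)) (fun _ => rfl) (hq j)).mul (isWeightedHomogeneous_X 𝕜 _ (Sum.inr j))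
  convert this using 1
  simp

/-- The bidegree and the image in the plane `Z = A X + B Y` of every value of `D_A^a D_B^b`. -/
theorem IsIterate.planeMap_eq {n a b : ℕ} {F G : RTZ 𝕜} (hp : ∀ l, (p l).IsHomogeneous (μ₁ + μ₂))
    (hAB : IsMuBasis p A B μ₁ μ₂) (hpAB : p = A ⨯₃ B) (hα : α ≠ 0)
    (h : IsIterate p A B a b F G) (hF : IsBihomogeneous F n 1)
    (hFα : planeMap μ₁ μ₂ A B F = -curveEq α β) :
    (∃ m, m + a * μ₁ + b * μ₂ = n ∧ IsBihomogeneous G m (a + b + 1)) ∧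
      planeMap μ₁ μ₂ A B G =
        X (Sum.inr 0) ^ a * (-X (Sum.inr 1)) ^ b * -curveEq α β := by
  have hne : ∀ {a b : ℕ} {G : RTZ 𝕜}, planeMap μ₁ μ₂ A B G =
      X (Sum.inr 0) ^ a * (-X (Sum.inr 1)) ^ b * -curveEq α β → G ≠ 0 := by
    rintro a b G hG rfl
    rw [map_zero, eq_comm] at hG
    exact mul_ne_zero (mul_ne_zero (pow_ne_zero _ (X_ne_zero _))
      (pow_ne_zero _ (neg_ne_zero.2 (X_ne_zero _)))) (neg_ne_zero.2 (curveEq_ne_zero hα β)) hG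
  have hA := hAB.homogeneous_fst
  have hB := hAB.homogeneous_snd
  induction h with
  | refl => exact ⟨⟨n, by simp, hF⟩, by simpa using hFα⟩
  | @stepA a b F G H _ hD ih =>
    obtain ⟨⟨m, hm, hG⟩, hGα⟩ := ih hF hFα
    obtain ⟨k, hk, hH⟩ := isBihomogeneous_of_isDValue hp hB hG (hne hGα) hD
    refine ⟨⟨k + μ₂, ?_, ?_⟩, ?_⟩
    · rw [← hm, ← hk]; ring
    · rwa [show a + 1 + b + 1 = a + b + 1 + 1 by ring]
    · rw [planeMap_det hA hB hpAB (Or.inl ⟨rfl, rfl⟩) hD, hGα]; ring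
  | @stepB a b F G H _ hD ih =>
    obtain ⟨⟨m, hm, hG⟩, hGα⟩ := ih hF hFα
    obtain ⟨k, hk, hH⟩ := isBihomogeneous_of_isDValue hp hA hG (hne hGα) hD
    refine ⟨⟨k + μ₁, ?_, ?_⟩, ?_⟩
    · rw [← hm, ← hk]; ring
    · rwa [show a + (b + 1) + 1 = a + b + 1 + 1 by ring]
    · rw [planeMap_det hA hB hpAB (Or.inr ⟨rfl, rfl⟩) hD, hGα]; ring

/-- The operators can be applied as long as the degree in `T` before each step is at least
`μ + μ₂ - 1`. -/
theorem exists_isIterate {n a b : ℕ} {F : RTZ 𝕜} (hp : ∀ l, (p l).IsHomogeneous (μ₁ + μ₂))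
    (hAB : IsMuBasis p A B μ₁ μ₂) (hpAB : p = A ⨯₃ B) (hα : α ≠ 0) (h₂ : 0 < μ₂)
    (hF : IsBihomogeneous F n 1) (hFα : planeMap μ₁ μ₂ A B F = -curveEq α β)
    (hn : (1 ≤ b ∧ 2 * (μ₁ + μ₂) + a * μ₁ + b * μ₂ ≤ n + (μ₁ + μ₂) + 1) ∨
      (b = 0 ∧ 2 * μ₂ + a * μ₁ ≤ n + 1)) :
    ∃ G₁ G, IsIterate p A B a 0 F G₁ ∧ IsIterate p A B 0 b G₁ G := by
  have hstepA : ∀ a' ≤ a, ∃ G₁, IsIterate p A B a' 0 F G₁ := by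
    intro a' ha'
    induction a' with
    | zero => exact ⟨F, .refl F⟩
    | succ a' ih =>
      obtain ⟨G, hG⟩ := ih (by omega)
      obtain ⟨m, hm, hGm⟩ := (hG.planeMap_eq hp hAB hpAB hα hF hFα).1
      have h1 := Nat.mul_le_mul_right μ₁ ha'
      rw [Nat.succ_mul] at h1
      -- `D_A` needs degree at least `μ₁ + 2μ₂ - 1`; for `b ≥ 1`, one of the two `μ₂` comes from `b
      -- μ₂`.
      have h2 : 1 ≤ b → μ₂ ≤ b * μ₂ := fun h => Nat.le_mul_of_pos_left _ h
      obtain ⟨H, hH⟩ := exists_isDValue hp hAB (i := m) (by omega) hGm (by omega) B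
      exact ⟨H, hG.stepA hH⟩
  obtain ⟨G₁, hG₁⟩ := hstepA a le_rfl
  have hstepB : ∀ b' ≤ b, ∃ G, IsIterate p A B 0 b' G₁ G := by
    intro b' hb'
    induction b' with
    | zero => exact ⟨G₁, .refl G₁⟩
    | succ b' ih =>
      obtain ⟨G, hG⟩ := ih (by omega)
      obtain ⟨m, hm, hGm⟩ := ((hG₁.trans hG).planeMap_eq hp hAB hpAB hα hF hFα).1
      have h1 := Nat.mul_le_mul_right μ₂ hb'
      rw [Nat.succ_mul] at h1
      simp only [add_zero, zero_add] at hm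
      obtain ⟨H, hH⟩ := exists_isDValue hp hAB (i := m) (by omega) hGm (by omega) A
      exact ⟨H, hG.stepB hH⟩
  obtain ⟨G, hG⟩ := hstepB b le_rfl
  exact ⟨G₁, G, hG₁, hG⟩

/-- The image under `Φ'` of a generator `Ψ⁰_{i,a,b+1}` with `i + (a+1) μ₁ + (b+1) μ₂ = d`. -/
theorem IsPsi.PhiPrime_eq {i a b : ℕ} {P : RTXY 𝕜 μ₁ μ₂} (hα : α ≠ 0) (hβ : β ≠ 0)
    (hP : IsPsi μ₁ μ₂ d α β 0 i a b P) (hi : i + (a + 1) * μ₁ + (b + 1) * μ₂ = d) :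
    PhiPrime 𝕜 μ₁ μ₂ P = X (Sum.inr 0) ^ a * X (Sum.inr 1) ^ b * curveEq α β := by
  obtain ⟨-, s, hs, -, P₁, P₂, hP₁, hP₂, hspec, hI, rfl⟩ := hP
  -- Equality in the defining inequality of `S` leaves no room for `t`: `P₁` specializes to `α`
  -- itself, and membership in `𝓘` then forces `P₂` to specialize to `β`.
  obtain rfl : s = 0 := by omega
  rw [pow_zero, pow_zero, mul_one, mul_one] at hspec
  have h1 := PhiPrime_of_isTrihomogeneous hP₁
  have h2 := PhiPrime_of_isTrihomogeneous hP₂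
  rw [hspec] at h1
  rw [idealI, RingHom.mem_ker, ← curveMap_comp_PhiPrime, AlgHom.comp_apply, map_sub, h1, h2] at hI
  have hinj : ∀ {Q : RT 𝕜}, Q ≠ 0 → (incl Q : RTs 𝕜) ≠ 0 := fun h h0 =>
    h (incl_injective (by rw [h0, map_zero]))
  have hX : curveMap α β (X (Sum.inr 0)) = incl α * X (Sum.inr ()) := by simp [curveMap]
  have hY : curveMap α β (X (Sum.inr 1)) = incl β * X (Sum.inr ()) := by simp [curveMap]
  simp only [map_sub, map_mul, map_pow, map_incl _ (curveMap_X_inl α β), hX, hY] at hI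
  have hcancel : (incl β - incl (specialize μ₁ μ₂ P₂) : RTs 𝕜) = 0 := by
    refine (mul_eq_zero.1 (?_ : (incl α * X (Sum.inr ())) ^ (a + 1) *
      (incl β * X (Sum.inr ())) ^ b * (incl β - incl (specialize μ₁ μ₂ P₂)) = 0)).resolve_left
      (mul_ne_zero (pow_ne_zero _ (mul_ne_zero (hinj hα) (X_ne_zero _)))
        (pow_ne_zero _ (mul_ne_zero (hinj hβ) (X_ne_zero _))))
    rw [← hI]
    ring
  rw [← incl_injective (sub_eq_zero.1 hcancel)] at h2
  rw [map_sub, h1, h2, curveEq]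
  ring

theorem exists_isPsi {i a b : ℕ} (h₁ : 0 < μ₁) (h₂ : 0 < μ₂) (hα : α.IsHomogeneous (d - μ₁))
    (hβ : β.IsHomogeneous (d - μ₂)) (hi : i + (a + 1) * μ₁ + (b + 1) * μ₂ = d) :
    ∃ P, IsPsi μ₁ μ₂ d α β 0 i a b P := by
  have hd : i + a * μ₁ + b * μ₂ + (μ₁ + μ₂) = d := by rw [← hi]; ring
  obtain ⟨P₁, hP₁, hs₁⟩ := exists_isTrihomogeneous_specialize μ₁ μ₂ (i := i) (j := a) (k := b + 1)
    hα (by rw [Nat.succ_mul]; omega)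
  obtain ⟨P₂, hP₂, hs₂⟩ := exists_isTrihomogeneous_specialize μ₁ μ₂ (i := i) (j := a + 1) (k := b)
    hβ (by rw [Nat.succ_mul]; omega)
  refine ⟨P₁ - P₂, isMinGenS_of_eq h₁ h₂ (by rw [← hi]; ring), 0, by omega, le_rfl, P₁, P₂, hP₁,
    hP₂, by simpa using hs₁, ?_, rfl⟩
  have : PhiPrime 𝕜 μ₁ μ₂ (P₁ - P₂) =
      X (Sum.inr 0) ^ a * X (Sum.inr 1) ^ b * curveEq α β := by
    rw [map_sub, PhiPrime_of_isTrihomogeneous hP₁, PhiPrime_of_isTrihomogeneous hP₂, hs₁, hs₂,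
      curveEq]
    ring
  rw [idealI, RingHom.mem_ker, ← curveMap_comp_PhiPrime, AlgHom.comp_apply, this, map_mul,
    curveMap_curveEq, mul_zero]

end Iterates

end CurveRees

/-! ### The theorem. -/

open CurveRees

theorem theorem7p3 {𝕜 : Type*} [Field 𝕜] (d μ μ₁ μ₂ : ℕ)
    (f p q A B : Fin 3 → CurveRees.RT 𝕜) (α β : CurveRees.RT 𝕜)
    -- the parametrization
    (hd : 1 < d) (hf : ∀ i, (f i).IsHomogeneous d)
    (hgcd : ∀ g : CurveRees.RT 𝕜, (∀ i, g ∣ f i) → IsUnit g)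
    (hind : LinearIndependent 𝕜 f)
    -- the μ-basis `p, q` of `f` and the μ-basis `A, B` of `p`, scaled by Hilbert–Burch
    (hpq : CurveRees.IsMuBasis f p q μ (d - μ)) (hfpq : f = p ⨯₃ q)
    (hAB : CurveRees.IsMuBasis p A B μ₁ μ₂) (hpAB : p = A ⨯₃ B)
    (hμ : μ = μ₁ + μ₂) (hμ₁ : 0 < μ₁)
    -- the decomposition of `f` along `A, B`
    (hα : α.IsHomogeneous (d - μ₁)) (hβ : β.IsHomogeneous (d - μ₂))
    (hdec : ∀ i, f i = α * A i + β * B i)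
    -- the range of exponents
    (a b : ℕ)
    (hab : (1 ≤ b ∧ (d : ℤ) - μ - a * μ₁ - b * μ₂ ≥ μ - 1) ∨
      (b = 0 ∧ (d : ℤ) - μ - a * μ₁ ≥ μ + μ₂ - μ₁ - 1)) :
    -- `D_A^a D_B^b (q)` is defined: `a` times `D_A`, then `b` times `D_B`
    (∃ G₁ G : CurveRees.RTZ 𝕜,
      CurveRees.IsIterate p A B a 0 (CurveRees.movingLine q) G₁ ∧
      CurveRees.IsIterate p A B 0 b G₁ G) ∧
    -- `Ψ^0_{d-μ-aμ₁-bμ₂,a,b+1}` exists (here `d-μ-aμ₁-bμ₂ ≥ 1`, so subtraction never truncates)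
    (∃ P, CurveRees.IsPsi μ₁ μ₂ d α β 0 (d - μ - a * μ₁ - b * μ₂) a b P) ∧
    -- every value of `D_A^a D_B^b (q)`, in any order of application
    ∀ G : CurveRees.RTZ 𝕜, CurveRees.IsIterate p A B a b (CurveRees.movingLine q) G →
      CurveRees.IsBihomogeneous G (d - μ - a * μ₁ - b * μ₂) (a + b + 1) ∧
      G ∈ CurveRees.idealK f ∧
      CurveRees.IsMinimalGenerator (CurveRees.idealK f) G ∧
      CurveRees.Gam μ₁ μ₂ A B G ∈ CurveRees.idealI μ₁ μ₂ α β ∧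
      ∀ P, CurveRees.IsPsi μ₁ μ₂ d α β 0 (d - μ - a * μ₁ - b * μ₂) a b P →
        CurveRees.Gam μ₁ μ₂ A B G - (-1) ^ (b + 1) * P ∈ CurveRees.idealIPrime 𝕜 μ₁ μ₂ := by
  have hA := hAB.homogeneous_fst
  have hB := hAB.homogeneous_snd
  have hp := hpq.homogeneous_fst
  have h12 := hAB.le
  have hle := hpq.le
  subst hμ
  have h₂ : 0 < μ₂ := by omega
  have hα0 : α ≠ 0 := by
    rintro rfl
    refine not_isUnit_of_isHomogeneous hβ (by omega) (hgcd β fun i => ?_)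
    exact ⟨B i, by rw [hdec, zero_mul, zero_add]⟩
  have hβ0 : β ≠ 0 := by
    rintro rfl
    refine not_isUnit_of_isHomogeneous hα (by omega) (hgcd α fun i => ?_)
    exact ⟨A i, by rw [hdec, zero_mul, add_zero]⟩
  have hαβ : IsRelPrime α β := fun g hgα hgβ => hgcd g fun i => by
    rw [hdec]
    exact dvd_add (hgα.mul_right _) (hgβ.mul_right _)
  have hq := isBihomogeneous_movingLine hpq.homogeneous_snd
  have hqα := planeMap_movingLine hAB hfpq hpAB hdec
  have hn : (1 ≤ b ∧ 2 * (μ₁ + μ₂) + a * μ₁ + b * μ₂ ≤ (d - (μ₁ + μ₂)) + (μ₁ + μ₂) + 1) ∨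
      (b = 0 ∧ 2 * μ₂ + a * μ₁ ≤ (d - (μ₁ + μ₂)) + 1) := by
    have hd' : ((d - (μ₁ + μ₂) : ℕ) : ℤ) = d - (μ₁ + μ₂) := by
      rw [Nat.cast_sub (by omega)]; push_cast; ring
    rcases hab with ⟨h, h'⟩ | ⟨h, h'⟩
    · refine Or.inl ⟨h, ?_⟩
      zify
      rw [hd']
      push_cast at h' ⊢
      linarith
    · refine Or.inr ⟨h, ?_⟩
      zify
      rw [hd']
      push_cast at h' ⊢
      linarith
  have hi : d - (μ₁ + μ₂) - a * μ₁ - b * μ₂ + (a + 1) * μ₁ + (b + 1) * μ₂ = d := by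
    rw [Nat.succ_mul, Nat.succ_mul]
    have : b = 0 → b * μ₂ = 0 := fun h => by rw [h, zero_mul]
    omega
  refine ⟨exists_isIterate hp hAB hpAB hα0 h₂ hq hqα hn, exists_isPsi hμ₁ h₂ hα hβ hi,
    fun G hG => ?_⟩
  obtain ⟨⟨m, hm, hGm⟩, hGα⟩ := hG.planeMap_eq hp hAB hpAB hα0 hq hqα
  obtain rfl : m = d - (μ₁ + μ₂) - a * μ₁ - b * μ₂ := by omega
  have hψ : psi f G = 0 := by
    rw [← curveMap_comp_planeMap hA hB hdec, AlgHom.comp_apply, hGα, map_mul, map_neg,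
      curveMap_curveEq, neg_zero, mul_zero]
  refine ⟨hGm, hψ, isMinimalGenerator_of_notMem hf hGm hψ fun hmem => ?_, ?_, fun P hP => ?_⟩
  · obtain ⟨g, hg, hg0⟩ := exists_planeMap_eq_of_mem_mul hf hA hB hμ₁ h₂ hdec hβ0 hαβ hmem
    -- The quotient is free of `T`, so setting `T = 0` leaves it unchanged and nonzero.
    have hgeq : g = -(MvPolynomial.X (Sum.inr 0) ^ a * (-MvPolynomial.X (Sum.inr 1)) ^ b) := by
      refine mul_left_cancel₀ (curveEq_ne_zero hα0 β) ?_
      rw [← hg, hGα]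
      ring
    rw [hgeq] at hg0
    simp [evalT, MvPolynomial.X_ne_zero] at hg0
  · rw [idealI, RingHom.mem_ker, ← curveMap_comp_PhiPrime, AlgHom.comp_apply]
    change curveMap α β (planeMap μ₁ μ₂ A B G) = 0
    rw [← AlgHom.comp_apply, curveMap_comp_planeMap hA hB hdec, hψ]
  · rw [idealIPrime, RingHom.mem_ker, map_sub, map_mul, hP.PhiPrime_eq hα0 hβ0 hi, map_pow,
      map_neg, map_one]
    change planeMap μ₁ μ₂ A B G - _ = 0
    rw [hGα, neg_pow (MvPolynomial.X (Sum.inr 1) : RTxy 𝕜)]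
    ring
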